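/- Let $n,d$ be positive integers, $r>0$, and let $\mathcal C_r$ be the space of continuous $\phi:(-\infty,0]\to\mathbb R^n$ for which $\lim_{u\to-\infty}e^{ru}\phi(u)$ exists, with norm $\|\phi\|_r=\sup_{u\le 0}e^{ru}|\phi(u)|$. Let $B$ be a $d$-dimensional Brownian motion on a probability space, and let $f:\mathcal C_r\to\mathbb R^n$, $g:\mathcal C_r\to\mathbb R^{n\times d}$ satisfy the following. (A) For each $R>0$ there are constants $K_R,K'_R>0$ with $|f(\phi)-f(\varphi)|\le K_R\|\phi-\varphi\|_r$ and $|g(\phi)-g(\varphi)|\le K'_R\|\phi-\varphi\|_r$ whenever $\|\phi\|_r\vee\|\varphi\|_r\le R$ (where $|\cdot|$ is the Euclidean norm of vectors and the Frobenius norm of matrices). (B) There are $a_1>0$, $a_2\ge 0$, $\bar p>2$ and a probability measure $\mu_1$ on $(-\infty,0]$ with $\int e^{-\bar p r u}\mu_1(\mathrm du)<\infty$ such that, for all $\phi\in\mathcal C_r$, $\langle\phi(0),f(\phi)\rangle\le a_1(1+\|\phi\|_r^2)-a_2|\phi(0)|^{\bar p}+a_2\int_{-\infty}^0|\phi(u)|^{\bar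 p}\mu_1(\mathrm du)$ and $|g(\phi)|^2\le a_1(1+\|\phi\|_r^2)$. Let $\Lambda:[0,\infty)\to[0,\infty)$ be nondecreasing with $|f(\phi)-f(\varphi)|\le\Lambda(R)\|\phi-\varphi\|_r$ whenever $R\ge 0$ and $\|\phi\|_r\vee\|\varphi\|_r\le R$. Put $\Lambda^{-1}(y)=\sup\{R\ge 0:\Lambda(R)\le y\}\in[0,\infty]$ (with $\sup\emptyset=0$), except that $\Lambda^{-1}\equiv\infty$ if $\Lambda$ is constant. Let $L=1\vee|f(0)|$ and $\theta\in(0,1/2]$. For a step size $\Delta=1/l$ with $l\ge 1$ an integer, let $t_j=j\Delta$ for $j\in\mathbb Z$, and let $\Pi^\Delta(x)=\big(|x|\wedge\Lambda^{-1}(L\Delta^{-\theta})\big)\,x/|x|$, with $x/|x|=0$ for $x=0$. For an integer $k\ge 1$ and $\xi\in\mathcal C_r$ the truncated Euler–Maruyama (TEM) scheme is $$Y^{k,\Delta}(t_j)=\xi(t_j)\ (-kl\le j\le 0),\qquad X^{k,\Delta}(t_j)=\Pi^\Delta\big(Y^{k,\Delta}(t_j)\big)\ (j\ge -kl),$$ $$Y^{k,\Delta}(t_{j+1})=X^{k,\Delta}(t_j)+f(X^{k,\Delta}_{t_j})\Delta+g(X^{k,\Delta}_{t_j})\big(B(t_{j+1})-B(t_j)\big)\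 (j\ge 0),$$ where for $j\ge 0$ the segment $X^{k,\Delta}_{t_j}\in\mathcal C_r$ is given by $$X^{k,\Delta}_{t_j}(u)=\frac{t_{m+1}-u}{\Delta}X^{k,\Delta}(t_{j+m})+\frac{u-t_m}{\Delta}X^{k,\Delta}(t_{j+m+1})\quad\text{for } t_m\le u\le t_{m+1},\ -kl\le m\le -1,$$ and $X^{k,\Delta}_{t_j}(u)=X^{k,\Delta}(t_j-k)$ for $u<-k$. Put $X^{k,\Delta}_t=X^{k,\Delta}_{t_j}$ for $t\in[t_j,t_{j+1})$. Then for every $p>0$ there is a constant $C>0$ such that for every $\xi\in\mathcal C_r$ there is a constant $C_\xi>0$ with $$\sup_{k\ge 1}\ \sup_{\Delta=1/l,\ l\ge 1}\ \mathbb E\Big(\sup_{0\le t\le T}\|X^{k,\Delta}_t\|_r^p\Big)\le C_{T,\xi}\qquad\text{for all }T>0,$$ where $C_{T,\xi}=C_\xi e^{CT}$ if $a_2=0$ and $C_{T,\xi}=C_\xi e^{C\,T^{\max(1,\,p/2)}}$ if $a_2>0$. The constants $C$ and $C_\xi$ do not depend on $T$, $k$, $\Delta$, and $C$ does not depend on $\xi$.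 -/

import Mathlib

open MeasureTheory ProbabilityTheory Filter Topology
open scoped NNReal ENNReal

noncomputable section

namespace TEM

/-- The Euclidean space `ℝⁿ`. -/
abbrev Vec (n : ℕ) : Type := EuclideanSpace ℝ (Fin n)

/-- The half-line `ℝ₋ = (-∞, 0]`. -/
abbrev RMinus : Type := Set.Iic (0 : ℝ)

/-! ### The phase space with fading memory -/

/-- The phase space `C_r` of the continuous `φ : ℝ₋ → ℝⁿ` for which `lim_{u → -∞} e^{ru} φ(u)`
exists in `ℝⁿ`. -/
def FadingSpace (r : ℝ) (n : ℕ) : Submodule ℝ C(RMinus, Vec n) where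
  carrier := {φ | ∃ c : Vec n,
    Tendsto (fun u : RMinus => Real.exp (r * (u : ℝ)) • φ u) atBot (𝓝 c)}
  add_mem' := by
    rintro φ ψ ⟨a, ha⟩ ⟨b, hb⟩
    exact ⟨a + b, by simpa [smul_add] using ha.add hb⟩
  zero_mem' := ⟨0, by simp⟩
  smul_mem' := by
    rintro c φ ⟨a, ha⟩
    refine ⟨c • a, ?_⟩
    have h := ha.const_smul c
    refine h.congr fun u => ?_
    simp [smul_comm c]

/-- Evaluation `φ(u)` of an element of the phase space. -/
def evalAt {r : ℝ} {n : ℕ} (φ : FadingSpace r n) (u : RMinus) : Vec n := φ.1 u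

/-- The norm `‖φ‖_r = sup_{u ≤ 0} e^{ru} |φ(u)|`. -/
def fadingNorm {r : ℝ} {n : ℕ} (φ : FadingSpace r n) : ℝ :=
  ⨆ u : RMinus, Real.exp (r * (u : ℝ)) * ‖evalAt φ u‖

/-- The supremum that defines `‖φ‖_r` is a genuine one: the set of values is bounded. -/
theorem bddAbove_fadingNorm {r : ℝ} {n : ℕ} (φ : FadingSpace r n) :
    BddAbove (Set.range fun u : RMinus => Real.exp (r * (u : ℝ)) * ‖evalAt φ u‖) := by
  obtain ⟨c, hc⟩ := φ.2
  have hev : ∀ᶠ u : RMinus in atBot, Real.exp (r * (u : ℝ)) * ‖evalAt φ u‖ ≤ ‖c‖ + 1 := by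
    filter_upwards [hc.norm.eventually_le_const (lt_add_one ‖c‖)] with u hu
    simpa [norm_smul, evalAt] using hu
  obtain ⟨a, ha⟩ := eventually_atBot.1 hev
  have hcont : Continuous fun u : RMinus => Real.exp (r * (u : ℝ)) * ‖evalAt φ u‖ := by
    unfold evalAt
    fun_prop
  have hcomp : IsCompact ((↑) ⁻¹' Set.Icc (a : ℝ) 0 : Set RMinus) :=
    (isClosed_Iic.isClosedEmbedding_subtypeVal).isCompact_preimage isCompact_Icc
  obtain ⟨M, hM⟩ := hcomp.bddAbove_image hcont.continuousOn
  refine ⟨max (‖c‖ + 1) M, ?_⟩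
  rintro _ ⟨u, rfl⟩
  rcases le_total u a with h | h
  · exact (ha u h).trans (le_max_left _ _)
  · exact (hM ⟨u, ⟨h, u.2⟩, rfl⟩).trans (le_max_right _ _)

/-- The Euclidean (Frobenius, trace) norm of an `n × d` matrix. -/
def matNorm {n d : ℕ} (A : Matrix (Fin n) (Fin d) ℝ) : ℝ :=
  Real.sqrt (∑ i, ∑ j, A i j ^ 2)

/-! ### The standing assumptions -/

/-- The family `𝒫_a` of the probability measures `μ` on `ℝ₋` with `∫ e^{-au} μ(du) < ∞`. -/
structure MemExpMoment (a : ℝ) (μ : Measure RMinus) : Prop where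
  isProbabilityMeasure : IsProbabilityMeasure μ
  integrable : Integrable (fun u : RMinus => Real.exp (-a * (u : ℝ))) μ

/-- Local Lipschitz condition on the drift coefficient. -/
def DriftLocallyLipschitz {r : ℝ} {n : ℕ} (f : FadingSpace r n → Vec n) : Prop :=
  ∀ R : ℝ, 0 < R → ∃ K : ℝ, 0 < K ∧ ∀ φ ψ : FadingSpace r n,
    fadingNorm φ ≤ R → fadingNorm ψ ≤ R → ‖f φ - f ψ‖ ≤ K * fadingNorm (φ - ψ)

/-- Local Lipschitz condition on the diffusion coefficient. -/
def DiffusionLocallyLipschitz {r : ℝ} {n d : ℕ}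
    (g : FadingSpace r n → Matrix (Fin n) (Fin d) ℝ) : Prop :=
  ∀ R : ℝ, 0 < R → ∃ K : ℝ, 0 < K ∧ ∀ φ ψ : FadingSpace r n,
    fadingNorm φ ≤ R → fadingNorm ψ ≤ R → matNorm (g φ - g ψ) ≤ K * fadingNorm (φ - ψ)

/-- The value at `0 ∈ ℝ₋`. -/
def atZero {r : ℝ} {n : ℕ} (φ : FadingSpace r n) : Vec n := evalAt φ ⟨0, Set.mem_Iic.2 le_rfl⟩

/-- The Khasminskii-type growth condition with constants `a₁ > 0`, `a₂ ≥ 0`, `p̄ > 2` and the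
probability measure `μ₁ ∈ 𝒫_{p̄ r}`. -/
structure KhasminskiiGrowth {r : ℝ} {n d : ℕ} (f : FadingSpace r n → Vec n)
    (g : FadingSpace r n → Matrix (Fin n) (Fin d) ℝ) (a₁ a₂ pbar : ℝ)
    (μ₁ : Measure RMinus) : Prop where
  a₁_pos : 0 < a₁
  a₂_nonneg : 0 ≤ a₂
  two_lt_pbar : 2 < pbar
  memExpMoment : MemExpMoment (pbar * r) μ₁
  drift : ∀ φ : FadingSpace r n,
    inner ℝ (atZero φ) (f φ) ≤ a₁ * (1 + fadingNorm φ ^ 2) - a₂ * ‖atZero φ‖ ^ pbar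
      + a₂ * ∫ u, ‖evalAt φ u‖ ^ pbar ∂μ₁
  diffusion : ∀ φ : FadingSpace r n, matNorm (g φ) ^ 2 ≤ a₁ * (1 + fadingNorm φ ^ 2)

/-- `B` is a `d`-dimensional Brownian motion: its coordinates are independent one-dimensional
Brownian motions. -/
structure IsBrownianMotion {Ω : Type*} [MeasurableSpace Ω] {d : ℕ} (B : ℝ≥0 → Ω → Vec d)
    (P : Measure Ω) : Prop where
  measurable : ∀ t, Measurable (B t)
  coord : ∀ i : Fin d, IsBrownianReal (fun t ω => B t ω i) P
  indep : iIndepFun (fun (i : Fin d) (ω : Ω) (t : ℝ≥0) => B t ω i) P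

/-! ### The truncation mapping -/

open Classical in
/-- The inverse `Λ⁻¹(y)` of an increasing function `Λ : [0, ∞) → [0, ∞)`, as an element of
`[0, ∞]`: the supremum of the `R ≥ 0` with `Λ(R) ≤ y`, which is the value of the inverse function
when `Λ` is an increasing bijection onto `[Λ(0), ∞) ∋ y` (and `0` when `y < Λ(0)`).
If `Λ` is constant, then `Λ⁻¹ = ∞` by convention. -/
def invFun (Λ : ℝ≥0 → ℝ≥0) (y : ℝ) : ℝ≥0∞ :=
  if ∀ R, Λ R = Λ 0 then ⊤ else ⨆ (R : ℝ≥0) (_ : (Λ R : ℝ) ≤ y), (R : ℝ≥0∞)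

/-- `invFun` is the inverse function on the range of a strictly increasing `Λ`. -/
theorem invFun_apply {Λ : ℝ≥0 → ℝ≥0} (hΛ : StrictMono Λ) (R : ℝ≥0) :
    invFun Λ (Λ R) = R := by
  have h1 : ¬ ∀ S, Λ S = Λ 0 := fun h => one_ne_zero (hΛ.injective (h 1))
  rw [invFun, if_neg h1]
  apply le_antisymm
  · refine iSup₂_le fun S hS => ?_
    exact_mod_cast hΛ.le_iff_le.1 (by exact_mod_cast hS)
  · exact le_iSup₂_of_le R le_rfl le_rfl

/-- The truncation `x ↦ (|x| ∧ M) x / |x|` at level `M ∈ [0, ∞]`, with `x / |x| = 0` if `x = 0`. -/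
def truncate {n : ℕ} (M : ℝ≥0∞) (x : Vec n) : Vec n :=
  (min (ENNReal.ofReal ‖x‖) M).toReal • (‖x‖⁻¹ • x)

/-- The truncation mapping `Π^Δ` for `Δ = 1 / l`: truncation at the level `Λ⁻¹(L Δ^{-θ})`, where
`L = 1 ∨ |f(0)|`. -/
def truncMap {r : ℝ} {n : ℕ} (f : FadingSpace r n → Vec n) (Λ : ℝ≥0 → ℝ≥0) (θ : ℝ) (l : ℕ)
    (x : Vec n) : Vec n :=
  truncate (invFun Λ (max 1 ‖f 0‖ * (1 / (l : ℝ)) ^ (-θ))) x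

/-! ### Linear interpolation of the nodes -/

/-- Linear interpolation on the grid `ℤ`: for `m ≤ x ≤ m + 1` the value is
`(m + 1 - x) v(m) + (x - m) v(m + 1)`. -/
def interp {n : ℕ} (v : ℤ → Vec n) (x : ℝ) : Vec n :=
  ((⌊x⌋ : ℝ) + 1 - x) • v ⌊x⌋ + (x - (⌊x⌋ : ℝ)) • v (⌊x⌋ + 1)

theorem interp_eq {n : ℕ} (v : ℤ → Vec n) (m : ℤ) {x : ℝ} (h1 : (m : ℝ) ≤ x) (h2 : x ≤ m + 1) :
    interp v x = ((m : ℝ) + 1 - x) • v m + (x - (m : ℝ)) • v (m + 1) := by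
  rcases h2.lt_or_eq with h | h
  · have : ⌊x⌋ = m := Int.floor_eq_iff.2 ⟨h1, h⟩
    rw [interp, this]
  · have : ⌊x⌋ = m + 1 := by
      rw [h]
      exact_mod_cast Int.floor_intCast (R := ℝ) (m + 1)
    rw [interp, this, h]
    simp

theorem continuous_interp {n : ℕ} (v : ℤ → Vec n) : Continuous (interp v) := by
  have hlf : LocallyFinite fun m : ℤ => Set.Icc (m : ℝ) ((m : ℝ) + 1) :=
    locallyFinite_Icc_of_tendsto tendsto_intCast_atTop_atTop
      (tendsto_atBot_add_const_right _ _ (tendsto_intCast_atBot_iff.2 tendsto_id))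
  refine hlf.continuous ?_ (fun _ => isClosed_Icc) fun m => ?_
  · exact Set.iUnion_eq_univ_iff.2 fun x => ⟨⌊x⌋, Int.floor_le x, (Int.lt_floor_add_one x).le⟩
  · refine ContinuousOn.congr (f := fun x => ((m : ℝ) + 1 - x) • v m + (x - (m : ℝ)) • v (m + 1))
      (by fun_prop) fun x hx => interp_eq v m hx.1 hx.2

/-- The segment built from node values `v(i)` at the times `t_i = i Δ`, `Δ = 1 / l`, seen from the
time `t_j`: linear interpolation of `v` at `t_j + u` for `-k ≤ u ≤ 0`, frozen at the value
`v(j - k l)` for `u < -k`. -/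
def segment {r : ℝ} (hr : 0 < r) {n : ℕ} (k l : ℕ) (v : ℤ → Vec n) (j : ℕ) : FadingSpace r n :=
  ⟨⟨fun u => interp v ((j : ℝ) + max (u : ℝ) (-(k : ℝ)) * (l : ℝ)),
    (continuous_interp v).comp (by fun_prop)⟩, by
    refine ⟨0, ?_⟩
    have h0 : Tendsto (fun u : RMinus => (u : ℝ)) atBot atBot :=
      tendsto_atBot.2 fun b => eventually_atBot.2
        ⟨⟨min b 0, Set.mem_Iic.2 (min_le_right _ _)⟩, fun u hu => le_trans (by exact_mod_cast hu) (min_le_left b 0)⟩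
    have h1 : Tendsto (fun u : RMinus => Real.exp (r * (u : ℝ))) atBot (𝓝 0) :=
      Real.tendsto_exp_atBot.comp (h0.const_mul_atBot hr)
    have h2 := h1.smul_const (interp v ((j : ℝ) + -(k : ℝ) * (l : ℝ)))
    rw [zero_smul] at h2
    refine h2.congr' ?_
    filter_upwards [h0.eventually_le_atBot (-(k : ℝ))] with u hu
    simp [max_eq_right hu]⟩

/-- The segment on `[t_m, t_{m+1}]`, `-k l ≤ m ≤ -1`. -/
theorem segment_eval {r : ℝ} (hr : 0 < r) {n : ℕ} (k : ℕ) {l : ℕ} (hl : 1 ≤ l) (v : ℤ → Vec n)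
    (j : ℕ) (m : ℤ) (hm : -((k * l : ℕ) : ℤ) ≤ m) (u : RMinus)
    (h1 : (m : ℝ) / l ≤ u) (h2 : (u : ℝ) ≤ ((m : ℝ) + 1) / l) :
    evalAt (segment hr k l v j : FadingSpace r n) u =
      ((((m : ℝ) + 1) / l - u) / (1 / (l : ℝ))) • v (j + m)
        + (((u : ℝ) - (m : ℝ) / l) / (1 / (l : ℝ))) • v (j + m + 1) := by
  have hl0 : (0 : ℝ) < l := by exact_mod_cast hl
  have hm' : -((k : ℝ) * l) ≤ m := by exact_mod_cast hm
  rw [div_le_iff₀ hl0] at h1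
  rw [le_div_iff₀ hl0] at h2
  have hk : -(k : ℝ) ≤ u := by
    by_contra h
    have := mul_lt_mul_of_pos_right (not_le.1 h) hl0
    linarith
  change interp v ((j : ℝ) + max (u : ℝ) (-(k : ℝ)) * (l : ℝ)) = _
  rw [max_eq_left hk, interp_eq v (j + m) (by push_cast; linarith) (by push_cast; linarith)]
  congr 2
  · push_cast
    field_simp
    ring
  · push_cast
    field_simp
    ring

/-- The segment on `(-∞, -k)`. -/
theorem segment_eval_of_lt {r : ℝ} (hr : 0 < r) {n : ℕ} (k l : ℕ) (v : ℤ → Vec n)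
    (j : ℕ) (u : RMinus) (hu : (u : ℝ) < -k) :
    evalAt (segment hr k l v j : FadingSpace r n) u = v (j - (k * l : ℕ)) := by
  change interp v ((j : ℝ) + max (u : ℝ) (-(k : ℝ)) * (l : ℝ)) = _
  rw [max_eq_right hu.le, interp_eq v (j - (k * l : ℕ)) (by push_cast; linarith)
    (by push_cast; linarith)]
  have h : (j : ℝ) - k * l + 1 - (j + -(k * l)) = 1 := by ring
  push_cast
  simp [h]

/-! ### The truncated Euler-Maruyama scheme -/

/-- The grid time `t_i = i / l` for `i ≤ 0`, as a point of `ℝ₋` (and `0` for `i > 0`). -/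
def gridTime (l : ℕ) (i : ℤ) : RMinus := ⟨min ((i : ℝ) / l) 0, Set.mem_Iic.2 (min_le_right _ _)⟩

/-- The increment `ΔB_j = B(t_{j+1}) - B(t_j)` of a path, for `t_j = j / l`. -/
def increment {d : ℕ} (w : ℝ≥0 → Vec d) (l j : ℕ) : Vec d :=
  w (((j : ℝ≥0) + 1) / l) - w ((j : ℝ≥0) / l)

section Scheme

variable {r : ℝ} (hr : 0 < r) {n d : ℕ} (f : FadingSpace r n → Vec n)
  (g : FadingSpace r n → Matrix (Fin n) (Fin d) ℝ) (Λ : ℝ≥0 → ℝ≥0) (θ : ℝ)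
  (ξ : FadingSpace r n) (k l : ℕ) (w : ℝ≥0 → Vec d)

/-- The values `Y(t_i)`, `i ≤ j`, of the scheme along the driving path `w`, after `j` steps. -/
def history : ℕ → ℤ → Vec n
  | 0 => fun i => evalAt ξ (gridTime l i)
  | j + 1 =>
    let X : ℤ → Vec n := fun i => truncMap f Λ θ l (history j i)
    Function.update (history j) ((j : ℤ) + 1)
      (X j + (1 / (l : ℝ)) • f (segment hr k l X j)
        + WithLp.toLp 2 ((g (segment hr k l X j)).mulVec (increment w l j).ofLp))

/-- `Y^{k,Δ}(t_i)`, where `Δ = 1 / l` and `t_i = i Δ`. -/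
def nodeY (i : ℤ) : Vec n := history hr f g Λ θ ξ k l w i.toNat i

/-- `X^{k,Δ}(t_i) = Π^Δ(Y^{k,Δ}(t_i))`. -/
def nodeX (i : ℤ) : Vec n := truncMap f Λ θ l (nodeY hr f g Λ θ ξ k l w i)

/-- The segment `X^{k,Δ}_{t_j}`. -/
def nodeSegment (j : ℕ) : FadingSpace r n := segment hr k l (nodeX hr f g Λ θ ξ k l w) j

/-- The numerical segment `X^{k,Δ}_t`, equal to `X^{k,Δ}_{t_j}` for `t ∈ [t_j, t_{j+1})`. -/
def numericalSegment (t : ℝ) : FadingSpace r n :=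
  nodeSegment hr f g Λ θ ξ k l w ⌊t * (l : ℝ)⌋₊

/-- Initial values of the scheme. -/
theorem nodeY_of_nonpos {i : ℤ} (hi : i ≤ 0) :
    nodeY hr f g Λ θ ξ k l w i = evalAt ξ (gridTime l i) := by
  rw [nodeY, Int.toNat_of_nonpos hi, history]

theorem history_eq_nodeY (j : ℕ) {i : ℤ} (hi : i ≤ j) :
    history hr f g Λ θ ξ k l w j i = nodeY hr f g Λ θ ξ k l w i := by
  induction j with
  | zero => rw [nodeY, Int.toNat_of_nonpos (by simpa using hi)]
  | succ j ih =>
    rcases eq_or_ne i ((j : ℤ) + 1) with h | h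
    · have : i.toNat = j + 1 := by omega
      rw [nodeY, this]
    · rw [history, Function.update_of_ne h]
      exact ih (by push_cast at hi; omega)

theorem segment_congr {v v' : ℤ → Vec n} (j : ℕ) (h : ∀ i : ℤ, i ≤ j → v i = v' i) :
    segment hr k l v j = segment hr k l v' j := by
  apply Subtype.ext
  ext1 u
  change interp v ((j : ℝ) + max (u : ℝ) (-(k : ℝ)) * (l : ℝ))
    = interp v' ((j : ℝ) + max (u : ℝ) (-(k : ℝ)) * (l : ℝ))
  set x := (j : ℝ) + max (u : ℝ) (-(k : ℝ)) * (l : ℝ) with hx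
  have hxj : x ≤ j := by
    have h1 : max (u : ℝ) (-(k : ℝ)) ≤ 0 := max_le u.2 (by simp)
    have := mul_nonpos_of_nonpos_of_nonneg h1 (Nat.cast_nonneg (α := ℝ) l)
    linarith
  have hfl : ⌊x⌋ ≤ (j : ℤ) := by
    have := Int.floor_mono hxj
    simpa using this
  rcases hfl.lt_or_eq with h1 | h1
  · rw [interp, interp, h _ hfl, h _ (by omega)]
  · have hxe : x = j := le_antisymm hxj (by
      have := Int.floor_le x
      rw [h1] at this
      exact_mod_cast this)
    have hj : (j : ℝ) - (⌊x⌋ : ℝ) = 0 := by rw [h1]; simp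
    rw [interp, interp, h _ hfl, ← hxe] at *
    simp [hj]

/-- The recursion `Y(t_{j+1}) = X(t_j) + f(X_{t_j}) Δ + g(X_{t_j}) ΔB_j` of the scheme. -/
theorem nodeY_succ (j : ℕ) :
    nodeY hr f g Λ θ ξ k l w ((j : ℤ) + 1) =
      nodeX hr f g Λ θ ξ k l w j
        + (1 / (l : ℝ)) • f (nodeSegment hr f g Λ θ ξ k l w j)
        + WithLp.toLp 2
          ((g (nodeSegment hr f g Λ θ ξ k l w j)).mulVec (increment w l j).ofLp) := by
  have hX : ∀ i : ℤ, i ≤ j → truncMap f Λ θ l (history hr f g Λ θ ξ k l w j i)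
      = nodeX hr f g Λ θ ξ k l w i := fun i hi => by
    rw [nodeX, history_eq_nodeY hr f g Λ θ ξ k l w j hi]
  have h : ((j : ℤ) + 1).toNat = j + 1 := by omega
  rw [nodeY, h, history, nodeSegment, ← segment_congr hr k l j hX, ← hX j le_rfl]
  simp

end Scheme

end TEM

end

/-! Squaring one step of the scheme gives |X(t_{j+1})|² ≤ |X(t_j)|² + (terms of order Δ +
|ΔB_j|²)·(1 + ‖X_{t_j}‖_r²) + a noise linear in ΔB_j + 2a₂Δ(∫|X_{t_j}|^p̄ dμ₁ − |X(t_j)|^p̄).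
Truncation makes |f(X_{t_j})Δ|² of order Δ(1 + ‖X_{t_j}‖_r²), because Δ^{1-θ} ≤ Δ^{1/2}
(`sq_mul_norm_drift_le`). The last bracket has no sign, but its sum over the steps does not exceed a
constant depending on ξ: exchanging sum and integral, the memory integral averages time shifts of
the same sequence, and a backward shift adds only values of the initial segment, which are
integrable against μ₁ (`sum_integral_segment_le`, `sum_memory_le`). Hence a₂ affects only the
starting value.

What remains is a linear recursive inequality with memory. It is compared pathwise with a scalar
process Z_{j+1} = Z_j + S_j e_j + δ_j, where S is the running maximum of Z and δ_j is exactly the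
noise of the scheme (`le_majorant`). Then |X(t_j)|² ≤ Z_j and 1 + ‖X_{t_j}‖_r² ≤ 2S_j, so Z ≥ 0 and
|δ_j| ≤ S_j y_j, where e_j and y_j depend on ΔB_j alone.

The moments of S come from `integral_majorant_snd_pow_le`. A pathwise Doob inequality
(`majorant_snd_pow_le`) gives E S_J^{2m+2} ≤ 4 E Z_J^{2m+2}. A Taylor expansion of Z^{2m+2} loses
its term linear in δ_j in the mean, and everything else costs a factor 1 + O(Δ)
(`IsBrownianMotion.exists_noise_bound`). Over J ≤ T/Δ steps this gives e^{CT}, with ξ entering only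
through the prefactor and without dependence on k or Δ. The rate e^{CT} is obtained for every a₂ ≥
0; the rate stated for a₂ > 0 follows from it. -/

namespace TEM

/-! ### A discrete Gronwall-Doob estimate -/

/-- The pair `(Z_j, S_j)` with `Z_0 = S_0 = z`, `Z_{j+1} = Z_j + S_j e_j + δ_j` and
`S_j = max_{i ≤ j} Z_i`. -/
noncomputable def majorant (z : ℝ) (δ e : ℕ → ℝ) : ℕ → ℝ × ℝ
  | 0 => (z, z)
  | j + 1 =>
    ((majorant z δ e j).1 + (majorant z δ e j).2 * e j + δ j,
      max (majorant z δ e j).2 ((majorant z δ e j).1 + (majorant z δ e j).2 * e j + δ j))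

section Deterministic

variable (z : ℝ) (δ e : ℕ → ℝ)

theorem majorant_succ_fst (j : ℕ) : (majorant z δ e (j + 1)).1 =
    (majorant z δ e j).1 + (majorant z δ e j).2 * e j + δ j := rfl

theorem majorant_succ_snd (j : ℕ) : (majorant z δ e (j + 1)).2 =
    max (majorant z δ e j).2 (majorant z δ e (j + 1)).1 := rfl

theorem majorant_fst_le_snd (j : ℕ) : (majorant z δ e j).1 ≤ (majorant z δ e j).2 := by
  cases j with
  | zero => exact le_rfl
  | succ j => exact le_max_right _ _

theorem majorant_snd_mono : Monotone fun j => (majorant z δ e j).2 :=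
  monotone_nat_of_le_succ fun _ => le_max_left _ _

theorem le_majorant_snd (j : ℕ) : z ≤ (majorant z δ e j).2 :=
  majorant_snd_mono z δ e (Nat.zero_le j)

theorem majorant_fst_eq_sum (j : ℕ) : (majorant z δ e j).1 =
    z + ∑ i ∈ Finset.range j, ((majorant z δ e i).2 * e i + δ i) := by
  induction j with
  | zero => simp [majorant]
  | succ j ih => rw [Finset.sum_range_succ, majorant_succ_fst, ih]; ring

/-- The pathwise Doob inequality for the running maximum. -/
theorem majorant_snd_pow_le (m J : ℕ) :
    (majorant z δ e J).2 ^ (2 * m) ≤ 4 * (majorant z δ e J).1 ^ (2 * m)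
      - 4 * ∑ i ∈ Finset.range J, (majorant z δ e i).2 ^ m *
        ((majorant z δ e (i + 1)).1 ^ m - (majorant z δ e i).1 ^ m) := by
  -- With s = S^m and x = Z^m, the quantity 4sx − 2s² − 4∑ s_i(x_{i+1} − x_i) is unchanged while the
  -- maximum stays and grows by 2(x' − s)² when a new maximum x' is reached. The inequality 4sx ≤ s²
  -- + 4x² then gives the claim.
  have key : 0 ≤ 4 * ((majorant z δ e J).2 ^ m * (majorant z δ e J).1 ^ m)
      - 2 * ((majorant z δ e J).2 ^ m) ^ 2
      - 4 * ∑ i ∈ Finset.range J, (majorant z δ e i).2 ^ m *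
        ((majorant z δ e (i + 1)).1 ^ m - (majorant z δ e i).1 ^ m) := by
    induction J with
    | zero =>
      simp only [majorant, Finset.range_zero, Finset.sum_empty]
      nlinarith [sq_nonneg (z ^ m)]
    | succ J ih =>
      rw [Finset.sum_range_succ]
      have hs := majorant_succ_snd z δ e J
      rcases max_choice (majorant z δ e J).2 (majorant z δ e (J + 1)).1 with h | h
      · rw [h] at hs
        rw [hs]
        linarith
      · rw [h] at hs
        rw [hs]
        nlinarith [sq_nonneg ((majorant z δ e (J + 1)).1 ^ m - (majorant z δ e J).2 ^ m)]
  rw [mul_comm 2 m, pow_mul, pow_mul]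
  nlinarith [sq_nonneg ((majorant z δ e J).2 ^ m - 2 * (majorant z δ e J).1 ^ m)]

end Deterministic

/-! ### Polynomial inequalities: tangent line and Taylor remainder -/

/-- Convexity of the power on [0, ∞): the graph lies above its tangent at a. -/
theorem pow_succ_sub_ge (k : ℕ) {a b : ℝ} (ha : 0 ≤ a) (hb : 0 ≤ b) :
    (k + 1) * a ^ k * (b - a) ≤ b ^ (k + 1) - a ^ (k + 1) := by
  induction k with
  | zero => simp
  | succ k ih =>
    have h1 := mul_le_mul_of_nonneg_left ih hb
    have h2 : 0 ≤ (k + 1) * a ^ k * (b - a) ^ 2 := by positivity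
    push_cast
    ring_nf at h1 h2 ⊢
    linarith

/-- The binomial theorem with the orders 0 and 1 split off, so that the remainder estimates below
can compare the sums term by term. -/
theorem add_pow_eq_taylor (k : ℕ) (u v : ℝ) : (u + v) ^ (k + 2) = u ^ (k + 2)
    + (k + 2) * u ^ (k + 1) * v
    + ∑ i ∈ Finset.range (k + 1), v ^ (i + 2) * u ^ (k - i) * ((k + 2).choose (i + 2)) := by
  rw [add_comm u v, add_pow, Finset.sum_range_succ', Finset.sum_range_succ']
  have : ∀ i ∈ Finset.range (k + 1), v ^ (i + 1 + 1) * u ^ (k + 2 - (i + 1 + 1)) *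
      ((k + 2).choose (i + 1 + 1) : ℝ) = v ^ (i + 2) * u ^ (k - i) * ((k + 2).choose (i + 2)) := by
    intro i _
    congr 3
    omega
  rw [Finset.sum_congr rfl this]
  simp
  ring

/-- Every remaining term has order at least 2 in x ≤ su, hence carries a factor s². With s = √Δ the
remainder is of order Δ. -/
theorem one_add_pow_taylor_le (k : ℕ) {x s u : ℝ} (hx : 0 ≤ x) (hs : 0 ≤ s) (hs1 : s ≤ 1)
    (hu : 0 ≤ u) (hxu : x ≤ s * u) :
    (1 + x) ^ (k + 2) - 1 - (k + 2) * x ≤ s ^ 2 * (1 + u) ^ (k + 2) := by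
  have e1 := add_pow_eq_taylor k 1 x
  have e2 := add_pow_eq_taylor k 1 u
  simp only [one_pow, mul_one] at e1 e2
  have h : ∑ i ∈ Finset.range (k + 1), x ^ (i + 2) * ((k + 2).choose (i + 2) : ℝ) ≤
      s ^ 2 * ∑ i ∈ Finset.range (k + 1), u ^ (i + 2) * ((k + 2).choose (i + 2) : ℝ) := by
    rw [Finset.mul_sum]
    refine Finset.sum_le_sum fun i _ => ?_
    rw [← mul_assoc]
    refine mul_le_mul_of_nonneg_right ?_ (Nat.cast_nonneg _)
    calc x ^ (i + 2) ≤ (s * u) ^ (i + 2) := by gcongr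
      _ = s ^ 2 * s ^ i * u ^ (i + 2) := by ring
      _ ≤ s ^ 2 * 1 * u ^ (i + 2) := by gcongr; exact pow_le_one₀ hs hs1
      _ = _ := by ring
  have h2 : 0 ≤ s ^ 2 * (1 + (k + 2) * u) := by positivity
  rw [e1, e2]
  linarith

/-- First order Taylor expansion of a power, with remainder. -/
theorem add_pow_le_taylor (k : ℕ) {a b s x : ℝ} (ha : 0 ≤ a) (has : a ≤ s)
    (hx : 0 ≤ x) (hb : |b| ≤ s * x) :
    (a + b) ^ (k + 2) ≤ a ^ (k + 2) + (k + 2) * a ^ (k + 1) * b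
      + s ^ (k + 2) * ((1 + x) ^ (k + 2) - 1 - (k + 2) * x) := by
  have hs : 0 ≤ s := ha.trans has
  have e2 := add_pow_eq_taylor k 1 x
  simp only [one_pow, mul_one] at e2
  rw [add_pow_eq_taylor k a b]
  have : s ^ (k + 2) * ((1 + x) ^ (k + 2) - 1 - (k + 2) * x)
      = ∑ i ∈ Finset.range (k + 1), s ^ (k + 2) * (x ^ (i + 2) * ((k + 2).choose (i + 2))) := by
    rw [← Finset.mul_sum, e2]; ring
  rw [this]
  refine add_le_add le_rfl (Finset.sum_le_sum fun i hi => ?_)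
  have hi' : i ≤ k := by simpa [Nat.lt_succ_iff] using hi
  have h1 : b ^ (i + 2) ≤ (s * x) ^ (i + 2) :=
    (le_abs_self _).trans (by rw [abs_pow]; gcongr)
  calc b ^ (i + 2) * a ^ (k - i) * ((k + 2).choose (i + 2))
      ≤ (s * x) ^ (i + 2) * s ^ (k - i) * ((k + 2).choose (i + 2)) := by gcongr
    _ = s ^ (k + 2) * (x ^ (i + 2) * ((k + 2).choose (i + 2))) := by
      have : s ^ (k + 2) = s ^ (i + 2) * s ^ (k - i) := by
        rw [← pow_add]; congr 1; omega
      rw [this]; ring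

/-! ### Moments of the majorant under adapted, centred noise -/

theorem integral_mul_of_indep {Ω : Type*} {𝓖 mΩ : MeasurableSpace Ω} {P : Measure Ω}
    (h𝓖 : 𝓖 ≤ mΩ) {G V : Ω → ℝ} (hG : Measurable[𝓖] G)
    (hV : Measurable V) (hind : Indep 𝓖 (MeasurableSpace.comap V inferInstance) P)
    (hGi : Integrable G P) (hVi : Integrable V P) :
    Integrable (fun ω => G ω * V ω) P ∧ ∫ ω, G ω * V ω ∂P = (∫ ω, G ω ∂P) * ∫ ω, V ω ∂P := by
  have h : IndepFun G V P := by
    rw [IndepFun_iff_Indep]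
    exact indep_of_indep_of_le_left hind hG.comap_le
  exact ⟨h.integrable_mul hGi hVi,
    h.integral_mul_eq_mul_integral (hG.mono h𝓖 le_rfl).aestronglyMeasurable
      hV.aestronglyMeasurable⟩

section Stochastic

variable {Ω : Type*} {mΩ : MeasurableSpace Ω} {P : Measure Ω} [IsProbabilityMeasure P]
  {ℱ : ℕ → MeasurableSpace Ω} {z : ℝ} {δ e y : ℕ → Ω → ℝ}

theorem measurable_majorant (hmono : Monotone ℱ)
    (hδm : ∀ j, Measurable[ℱ (j + 1)] (δ j)) (hem : ∀ j, Measurable[ℱ (j + 1)] (e j)) (j : ℕ) :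
    Measurable[ℱ j] (fun ω => (majorant z (δ · ω) (e · ω) j).1) ∧
      Measurable[ℱ j] (fun ω => (majorant z (δ · ω) (e · ω) j).2) := by
  induction j with
  | zero => exact ⟨measurable_const, measurable_const⟩
  | succ j ih =>
    have h1 := ih.1.mono (hmono j.le_succ) le_rfl
    have h2 := ih.2.mono (hmono j.le_succ) le_rfl
    have h3 : Measurable[ℱ (j + 1)] (fun ω => (majorant z (δ · ω) (e · ω) (j + 1)).1) :=
      (h1.add (h2.mul (hem j))).add (hδm j)
    exact ⟨h3, h2.max h3⟩

/-- The new maximum is controlled by a factor built from e_j and y_j alone; once these are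
independent of the past, integrability passes from step to step. -/
theorem majorant_succ_snd_le (hz : 0 ≤ z) (he : ∀ j ω, 0 ≤ e j ω) (hy : ∀ j ω, 0 ≤ y j ω)
    (hδ : ∀ j ω, |δ j ω| ≤ (majorant z (δ · ω) (e · ω) j).2 * y j ω) (j : ℕ) (ω : Ω) :
    (majorant z (δ · ω) (e · ω) (j + 1)).2 ≤
      (majorant z (δ · ω) (e · ω) j).2 * (1 + (e j ω + y j ω)) := by
  have h0 := hz.trans (le_majorant_snd z (δ · ω) (e · ω) j)
  have h1 := majorant_fst_le_snd z (δ · ω) (e · ω) j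
  have h2 := (le_abs_self _).trans (hδ j ω)
  rw [majorant_succ_snd, majorant_succ_fst]
  refine max_le ?_ (by linarith)
  have := mul_nonneg h0 (add_nonneg (he j ω) (hy j ω))
  linarith

theorem integrable_majorant_snd_pow (hℱ : ∀ j, ℱ j ≤ mΩ) (hmono : Monotone ℱ) (hz : 0 ≤ z)
    (hδm : ∀ j, Measurable[ℱ (j + 1)] (δ j)) (hem : ∀ j, Measurable[ℱ (j + 1)] (e j))
    (hym : ∀ j, Measurable (y j)) (he : ∀ j ω, 0 ≤ e j ω) (hy : ∀ j ω, 0 ≤ y j ω)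
    (hδ : ∀ j ω, |δ j ω| ≤ (majorant z (δ · ω) (e · ω) j).2 * y j ω)
    (hind : ∀ j, Indep (ℱ j)
      (MeasurableSpace.comap (fun ω => e j ω + y j ω) inferInstance) P)
    (hint : ∀ j k, Integrable (fun ω => (1 + (e j ω + y j ω)) ^ k) P) (k j : ℕ) :
    Integrable (fun ω => (majorant z (δ · ω) (e · ω) j).2 ^ k) P := by
  induction j with
  | zero => exact integrable_const (z ^ k)
  | succ j ih =>
    have hm := (measurable_majorant (z := z) hmono hδm hem j).2.pow_const k
    have hm' := (measurable_majorant (z := z) hmono hδm hem (j + 1)).2.pow_const k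
    have hV : Measurable (fun ω => e j ω + y j ω) :=
      ((hem j).mono (hℱ _) le_rfl).add (hym j)
    have hind' : Indep (ℱ j) (MeasurableSpace.comap
        (fun ω => (1 + (e j ω + y j ω)) ^ k) inferInstance) P := by
      refine indep_of_indep_of_le_right (hind j) ?_
      exact (((comap_measurable (fun ω => e j ω + y j ω)).const_add 1).pow_const k).comap_le
    refine (integral_mul_of_indep (hℱ j) hm ((hV.const_add 1).pow_const k) hind' ih
      (hint j k)).1.mono' (hm'.mono (hℱ _) le_rfl).aestronglyMeasurable (.of_forall fun ω => ?_)
    have h0 := hz.trans (le_majorant_snd z (δ · ω) (e · ω) (j + 1))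
    rw [Real.norm_of_nonneg (pow_nonneg h0 k), ← mul_pow]
    exact pow_le_pow_left₀ h0 (majorant_succ_snd_le hz he hy hδ j ω) k

/-- Let `Z_{j+1} = Z_j + S_j e_j + δ_j ≥ 0`, with `S` the running maximum of `Z`, with centred `δ_j`
of size at most `S_j y_j`, and with `(e_j, y_j)` independent of the past and small. Then the
moments of the running maximum grow at most exponentially. -/
theorem integral_majorant_snd_pow_le (hℱ : ∀ j, ℱ j ≤ mΩ) (hmono : Monotone ℱ) (hz : 0 ≤ z)
    (hδm : ∀ j, Measurable[ℱ (j + 1)] (δ j)) (hem : ∀ j, Measurable[ℱ (j + 1)] (e j))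
    (hym : ∀ j, Measurable (y j)) (he : ∀ j ω, 0 ≤ e j ω) (hy : ∀ j ω, 0 ≤ y j ω)
    (hδ : ∀ j ω, |δ j ω| ≤ (majorant z (δ · ω) (e · ω) j).2 * y j ω)
    (hind : ∀ j, Indep (ℱ j)
      (MeasurableSpace.comap (fun ω => e j ω + y j ω) inferInstance) P)
    (hinde : ∀ j, Indep (ℱ j) (MeasurableSpace.comap (e j) inferInstance) P)
    (hint : ∀ j k, Integrable (fun ω => (1 + (e j ω + y j ω)) ^ k) P)
    (hZ : ∀ j ω, 0 ≤ (majorant z (δ · ω) (e · ω) j).1)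
    (hzero : ∀ a b j, ∫ ω, (majorant z (δ · ω) (e · ω) j).2 ^ a *
      (majorant z (δ · ω) (e · ω) j).1 ^ b * δ j ω ∂P = 0)
    {m : ℕ} {κ : ℝ} (hκ : 0 ≤ κ) (heκ : ∀ j, ∫ ω, e j ω ∂P ≤ κ)
    (hxκ : ∀ j, ∫ ω, ((1 + (e j ω + y j ω)) ^ (2 * m + 2) - 1
      - (2 * m + 2) * (e j ω + y j ω)) ∂P ≤ κ) (J : ℕ) :
    ∫ ω, (majorant z (δ · ω) (e · ω) J).2 ^ (2 * m + 2) ∂P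
      ≤ 4 * z ^ (2 * m + 2) * (1 + 4 * ((2 * m + 3) * κ)) ^ J := by
  set Z : ℕ → Ω → ℝ := fun j ω => (majorant z (δ · ω) (e · ω) j).1 with hZdef
  set S : ℕ → Ω → ℝ := fun j ω => (majorant z (δ · ω) (e · ω) j).2 with hSdef
  have hZm : ∀ j, Measurable[ℱ j] (Z j) := fun j => (measurable_majorant hmono hδm hem j).1
  have hSm : ∀ j, Measurable[ℱ j] (S j) := fun j => (measurable_majorant hmono hδm hem j).2
  have hZS : ∀ j ω, Z j ω ≤ S j ω := fun j ω => majorant_fst_le_snd _ _ _ j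
  have hS0 : ∀ j ω, 0 ≤ S j ω := fun j ω => hz.trans (le_majorant_snd _ _ _ j)
  have hSi : ∀ k j, Integrable (fun ω => S j ω ^ k) P :=
    integrable_majorant_snd_pow hℱ hmono hz hδm hem hym he hy hδ hind hint
  have hem' : ∀ j, Measurable (e j) := fun j => (hem j).mono (hℱ _) le_rfl
  have hδm' : ∀ j, Measurable (δ j) := fun j => (hδm j).mono (hℱ _) le_rfl
  have hxi : ∀ j, Integrable (fun ω => e j ω + y j ω) P := fun j => by
    have := (hint j 1).sub (integrable_const 1)
    exact this.congr (.of_forall fun ω => by simp)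
  have hei : ∀ j, Integrable (e j) P := fun j =>
    (hxi j).mono' (hem' j).aestronglyMeasurable (.of_forall fun ω => by
      rw [Real.norm_of_nonneg (he j ω)]; linarith [hy j ω])
  have hSxi : ∀ k j, Integrable (fun ω => S j ω ^ k * (e j ω + y j ω)) P := fun k j =>
    (integral_mul_of_indep (hℱ j) ((hSm j).pow_const k) ((hem' j).add (hym j)) (hind j)
      (hSi k j) (hxi j)).1
  have hSei : ∀ k j, Integrable (fun ω => S j ω ^ k * e j ω) P ∧
      ∫ ω, S j ω ^ k * e j ω ∂P = (∫ ω, S j ω ^ k ∂P) * ∫ ω, e j ω ∂P := fun k j =>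
    integral_mul_of_indep (hℱ j) ((hSm j).pow_const k) (hem' j) (hinde j) (hSi k j) (hei j)
  have hSZm : ∀ a b j, Measurable (fun ω => S j ω ^ a * Z j ω ^ b) := fun a b j =>
    (((hSm j).pow_const a).mul ((hZm j).pow_const b)).mono (hℱ j) le_rfl
  have hSZ0 : ∀ a b j ω, 0 ≤ S j ω ^ a * Z j ω ^ b := fun a b j ω =>
    mul_nonneg (pow_nonneg (hS0 j ω) a) (pow_nonneg (hZ j ω) b)
  have hSZle : ∀ a b j ω, S j ω ^ a * Z j ω ^ b ≤ S j ω ^ (a + b) := fun a b j ω => by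
    rw [pow_add]
    exact mul_le_mul_of_nonneg_left (pow_le_pow_left₀ (hZ j ω) (hZS j ω) b)
      (pow_nonneg (hS0 j ω) a)
  have hSZi : ∀ a b j, Integrable (fun ω => S j ω ^ a * Z j ω ^ b) P := fun a b j =>
    (hSi (a + b) j).mono' (hSZm a b j).aestronglyMeasurable (.of_forall fun ω => by
      rw [Real.norm_of_nonneg (hSZ0 a b j ω)]; exact hSZle a b j ω)
  have hδi : ∀ a b j, Integrable (fun ω => S j ω ^ a * Z j ω ^ b * δ j ω) P := fun a b j =>
    (hSxi (a + b + 1) j).mono' ((hSZm a b j).mul (hδm' j)).aestronglyMeasurable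
      (.of_forall fun ω => by
        rw [norm_mul, Real.norm_of_nonneg (hSZ0 a b j ω), Real.norm_eq_abs,
          pow_succ (S j ω) (a + b), mul_assoc (S j ω ^ (a + b))]
        refine mul_le_mul (hSZle a b j ω) ((hδ j ω).trans ?_) (abs_nonneg _)
          (pow_nonneg (hS0 j ω) _)
        exact mul_le_mul_of_nonneg_left (by linarith [he j ω]) (hS0 j ω))
  -- Doob's inequality
  have hdoob : ∀ J, ∫ ω, S J ω ^ (2 * m + 2) ∂P ≤ 4 * ∫ ω, Z J ω ^ (2 * m + 2) ∂P := by
    intro J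
    have hZi : Integrable (fun ω => Z J ω ^ (2 * m + 2)) P := by
      simpa using hSZi 0 (2 * m + 2) J
    have hle : ∀ ω, S J ω ^ (2 * m + 2) ≤ 4 * Z J ω ^ (2 * m + 2)
        - 4 * ∑ i ∈ Finset.range J, (m + 1) * (S i ω ^ (m + 1) * Z i ω ^ m * δ i ω) := by
      intro ω
      have h1 := majorant_snd_pow_le z (δ · ω) (e · ω) (m + 1) J
      rw [mul_add] at h1
      refine h1.trans (sub_le_sub_left (mul_le_mul_of_nonneg_left
        (Finset.sum_le_sum fun i _ => ?_) (by norm_num)) _)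
      -- The sum enters with a minus sign, so lower bounds for the increments of Z^{m+1} suffice:
      -- the tangent bound, from which the nonnegative part S e is dropped. Only a term linear in
      -- the centred δ is left.
      have h2 := pow_succ_sub_ge m (hZ i ω) (hZ (i + 1) ω)
      have h3 : Z (i + 1) ω - Z i ω = S i ω * e i ω + δ i ω := by
        simp only [hZdef, hSdef, majorant_succ_fst]; ring
      have h3' : (majorant z (δ · ω) (e · ω) (i + 1)).1 - (majorant z (δ · ω) (e · ω) i).1
        = S i ω * e i ω + δ i ω := h3
      rw [h3'] at h2
      have h4 := mul_le_mul_of_nonneg_left h2 (pow_nonneg (hS0 i ω) (m + 1))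
      refine le_trans ?_ h4
      have h5 : 0 ≤ S i ω ^ (m + 1) * ((m + 1) * Z i ω ^ m * (S i ω * e i ω)) := by
        have := hS0 i ω
        have := hZ i ω
        have := he i ω
        positivity
      simp only [hZdef] at h5 ⊢
      linarith
    calc ∫ ω, S J ω ^ (2 * m + 2) ∂P
        ≤ ∫ ω, (4 * Z J ω ^ (2 * m + 2)
          - 4 * ∑ i ∈ Finset.range J, (m + 1) * (S i ω ^ (m + 1) * Z i ω ^ m * δ i ω)) ∂P :=
        integral_mono (hSi _ J) ((hZi.const_mul 4).sub ((integrable_finsetSum _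
          fun i _ => (hδi (m + 1) m i).const_mul _).const_mul 4)) hle
      _ = 4 * ∫ ω, Z J ω ^ (2 * m + 2) ∂P := by
        rw [integral_sub (hZi.const_mul 4) ((integrable_finsetSum _
          fun i _ => (hδi (m + 1) m i).const_mul _).const_mul 4), integral_const_mul,
          integral_const_mul, integral_finsetSum _ fun i _ => (hδi (m + 1) m i).const_mul _]
        simp only [integral_const_mul]
        rw [Finset.sum_eq_zero fun i _ => by rw [hzero]; ring]
        ring
  -- one step
  have hstep : ∀ j, ∫ ω, Z (j + 1) ω ^ (2 * m + 2) ∂P ≤ ∫ ω, Z j ω ^ (2 * m + 2) ∂P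
      + (2 * m + 3) * κ * ∫ ω, S j ω ^ (2 * m + 2) ∂P := by
    intro j
    -- The Taylor remainder is a function of e + y, hence independent of the past, and its mean
    -- factors out.
    set R : Ω → ℝ := fun ω => (1 + (e j ω + y j ω)) ^ (2 * m + 2) - 1
      - (2 * m + 2) * (e j ω + y j ω) with hR
    have hRi : Integrable R P :=
      ((hint j _).sub (integrable_const 1)).sub ((hxi j).const_mul _)
    have hRind : Indep (ℱ j) (MeasurableSpace.comap R inferInstance) P := by
      refine indep_of_indep_of_le_right (hind j) ?_
      have h : Measurable[MeasurableSpace.comap (fun ω => e j ω + y j ω) inferInstance]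
        (fun ω => e j ω + y j ω) := comap_measurable _
      exact ((((h.const_add 1).pow_const _).sub_const 1).sub (h.const_mul _)).comap_le
    have hRm : Measurable R := by
      have h := (hem' j).add (hym j)
      exact (((h.const_add 1).pow_const _).sub_const 1).sub (h.const_mul _)
    obtain ⟨hSRi, hSR⟩ := integral_mul_of_indep (hℱ j) ((hSm j).pow_const (2 * m + 2)) hRm hRind
      (hSi _ j) hRi
    have hZi : ∀ j, Integrable (fun ω => Z j ω ^ (2 * m + 2)) P := fun j => by
      simpa using hSZi 0 (2 * m + 2) j
    -- The factor `S j ω ^ 0` only brings the linear term into the form covered by `hδi` and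
    -- `hzero`.
    have hle : ∀ ω, Z (j + 1) ω ^ (2 * m + 2) ≤ Z j ω ^ (2 * m + 2)
        + (2 * m + 2) * (S j ω ^ (2 * m + 2) * e j ω)
        + (2 * m + 2) * (S j ω ^ 0 * Z j ω ^ (2 * m + 1) * δ j ω)
        + S j ω ^ (2 * m + 2) * R ω := by
      intro ω
      have h3 : Z (j + 1) ω = Z j ω + (S j ω * e j ω + δ j ω) := by
        simp only [hZdef, hSdef, majorant_succ_fst]; ring
      have hb : |S j ω * e j ω + δ j ω| ≤ S j ω * (e j ω + y j ω) := by
        refine (abs_add_le _ _).trans ?_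
        rw [abs_of_nonneg (mul_nonneg (hS0 j ω) (he j ω)), mul_add]
        exact add_le_add le_rfl (hδ j ω)
      have h1 := add_pow_le_taylor (2 * m) (hZ j ω) (hZS j ω)
        (add_nonneg (he j ω) (hy j ω)) hb
      have h4 : Z j ω ^ (2 * m + 1) * (S j ω * e j ω) ≤ S j ω ^ (2 * m + 2) * e j ω := by
        rw [pow_succ (S j ω) (2 * m + 1), mul_assoc]
        exact mul_le_mul_of_nonneg_right (pow_le_pow_left₀ (hZ j ω) (hZS j ω) _)
          (mul_nonneg (hS0 j ω) (he j ω))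
      have h5 := mul_le_mul_of_nonneg_left h4 (by positivity : (0 : ℝ) ≤ 2 * m + 2)
      rw [h3]
      push_cast at h1
      refine h1.trans ?_
      simp only [hR, hZdef] at h5 ⊢
      linarith
    have i1 : Integrable (fun ω => Z j ω ^ (2 * m + 2)
        + (2 * m + 2) * (S j ω ^ (2 * m + 2) * e j ω)) P :=
      (hZi j).add ((hSei _ j).1.const_mul _)
    have i2 := i1.add ((hδi 0 (2 * m + 1) j).const_mul (2 * m + 2))
    have hI := integral_mono (hZi (j + 1)) (i2.add hSRi) hle
    refine hI.trans ?_
    have e1 := integral_add i2 hSRi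
    have e2 := integral_add i1 ((hδi 0 (2 * m + 1) j).const_mul (2 * m + 2))
    have e3 := integral_add (hZi j) ((hSei (2 * m + 2) j).1.const_mul (2 * m + 2 : ℝ))
    simp only [Pi.add_apply] at e1 e2 e3
    simp only [integral_const_mul] at e2 e3
    simp only [Pi.add_apply]
    rw [e1, e2, e3, hzero, (hSei _ j).2, hSR]
    have hS : 0 ≤ ∫ ω, S j ω ^ (2 * m + 2) ∂P :=
      integral_nonneg fun ω => pow_nonneg (hS0 j ω) _
    have g1 := mul_le_mul_of_nonneg_left (heκ j) hS
    have g2 := mul_le_mul_of_nonneg_left (hxκ j) hS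
    have g3 := mul_le_mul_of_nonneg_left g1 (by positivity : (0 : ℝ) ≤ 2 * m + 2)
    linarith
  -- Gronwall
  set a : ℕ → ℝ := fun j => ∫ ω, S j ω ^ (2 * m + 2) ∂P with ha
  have hsum : ∀ J, ∫ ω, Z J ω ^ (2 * m + 2) ∂P
      ≤ z ^ (2 * m + 2) * (1 + 4 * ((2 * m + 3) * κ)) ^ J := by
    have hq : (0 : ℝ) ≤ (2 * m + 3) * κ := by positivity
    intro J
    induction J with
    | zero => simp [hZdef, majorant]
    | succ J ih =>
      have h1 := hstep J
      -- Doob's inequality replaces E S_J^{2m+2} by 4 E Z_J^{2m+2}, which closes the recursion on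
      -- the moments of Z.
      have h2 := mul_le_mul_of_nonneg_left (hdoob J) hq
      have h3 := mul_le_mul_of_nonneg_right ih
        (by positivity : (0 : ℝ) ≤ 1 + 4 * ((2 * m + 3) * κ))
      rw [pow_succ (1 + 4 * ((2 * (m : ℝ) + 3) * κ)), ← mul_assoc]
      refine le_trans ?_ h3
      linarith
  have := hdoob J
  have := hsum J
  linarith

end Stochastic

/-! ### The fading norm -/

section FadingNorm

variable {r : ℝ} {n : ℕ}

theorem exp_mul_norm_evalAt_le (φ : FadingSpace r n) (u : RMinus) :
    Real.exp (r * (u : ℝ)) * ‖evalAt φ u‖ ≤ fadingNorm φ :=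
  le_ciSup (bddAbove_fadingNorm φ) u

theorem fadingNorm_nonneg (φ : FadingSpace r n) : 0 ≤ fadingNorm φ :=
  Real.iSup_nonneg fun _ => by positivity

theorem fadingNorm_le {φ : FadingSpace r n} {b : ℝ}
    (h : ∀ u : RMinus, Real.exp (r * (u : ℝ)) * ‖evalAt φ u‖ ≤ b) : fadingNorm φ ≤ b :=
  ciSup_le h

theorem norm_evalAt_le (φ : FadingSpace r n) (u : RMinus) :
    ‖evalAt φ u‖ ≤ fadingNorm φ * Real.exp (-(r * (u : ℝ))) := by
  rw [Real.exp_neg, ← div_eq_mul_inv, le_div_iff₀' (Real.exp_pos _)]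
  exact exp_mul_norm_evalAt_le φ u

theorem norm_atZero_le (φ : FadingSpace r n) : ‖atZero φ‖ ≤ fadingNorm φ := by
  simpa [atZero] using norm_evalAt_le φ ⟨0, Set.mem_Iic.2 le_rfl⟩

theorem fadingNorm_zero : fadingNorm (0 : FadingSpace r n) = 0 := by
  simp [fadingNorm, evalAt]

theorem fadingNorm_smul (c : ℝ) (φ : FadingSpace r n) :
    fadingNorm (c • φ) = |c| * fadingNorm φ := by
  rw [fadingNorm, fadingNorm, Real.mul_iSup_of_nonneg (abs_nonneg c)]
  congr 1
  ext u
  have : evalAt (c • φ) u = c • evalAt φ u := rfl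
  rw [this, norm_smul, Real.norm_eq_abs]
  ring

theorem fadingNorm_le_add_sub (φ ψ : FadingSpace r n) :
    fadingNorm φ ≤ fadingNorm ψ + fadingNorm (φ - ψ) := by
  refine fadingNorm_le fun u => ?_
  have h1 := exp_mul_norm_evalAt_le ψ u
  have h2 := exp_mul_norm_evalAt_le (φ - ψ) u
  have h3 : evalAt (φ - ψ) u = evalAt φ u - evalAt ψ u := rfl
  have h4 : ‖evalAt φ u‖ ≤ ‖evalAt ψ u‖ + ‖evalAt φ u - evalAt ψ u‖ := by
    simpa using norm_add_le (evalAt ψ u) (evalAt φ u - evalAt ψ u)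
  have h5 := mul_le_mul_of_nonneg_left h4 (Real.exp_pos (r * (u : ℝ))).le
  rw [h3] at h2
  linarith

end FadingNorm

/-! ### Linear interpolation -/

section Interp

variable {n : ℕ}

theorem norm_interp_le {v : ℤ → Vec n} {x b : ℝ} (h1 : ‖v ⌊x⌋‖ ≤ b) (h2 : ‖v (⌊x⌋ + 1)‖ ≤ b) :
    ‖interp v x‖ ≤ b := by
  have h3 : 0 ≤ (⌊x⌋ : ℝ) + 1 - x := by linarith [Int.lt_floor_add_one x]
  have h4 : 0 ≤ x - ⌊x⌋ := by linarith [Int.floor_le x]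
  refine (norm_add_le _ _).trans ?_
  rw [norm_smul, norm_smul, Real.norm_of_nonneg h3, Real.norm_of_nonneg h4]
  nlinarith [mul_le_mul_of_nonneg_left h1 h3, mul_le_mul_of_nonneg_left h2 h4]

theorem interp_sub (v v' : ℤ → Vec n) (x : ℝ) : interp (v - v') x = interp v x - interp v' x := by
  simp only [interp, Pi.sub_apply, smul_sub]
  abel

/-- Convexity of t ↦ t^q. Because i is an integer, the interpolation weights depend on y only, so
the estimate can be summed over i with fixed weights. -/
theorem norm_interp_rpow_le (v : ℤ → Vec n) {q : ℝ} (hq : 1 ≤ q) (i : ℕ) (y : ℝ) :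
    ‖interp v (i + y)‖ ^ q ≤ ((⌊y⌋ : ℝ) + 1 - y) * ‖v (i + ⌊y⌋)‖ ^ q
      + (y - ⌊y⌋) * ‖v (i + (⌊y⌋ + 1))‖ ^ q := by
  have h3 : 0 ≤ (⌊y⌋ : ℝ) + 1 - y := by linarith [Int.lt_floor_add_one y]
  have h4 : 0 ≤ y - ⌊y⌋ := by linarith [Int.floor_le y]
  have hfl : ⌊(i : ℝ) + y⌋ = i + ⌊y⌋ := Int.floor_natCast_add i y
  have h5 : ‖interp v (i + y)‖ ≤ ((⌊y⌋ : ℝ) + 1 - y) * ‖v (i + ⌊y⌋)‖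
      + (y - ⌊y⌋) * ‖v (i + (⌊y⌋ + 1))‖ := by
    rw [interp, hfl]
    refine (norm_add_le _ _).trans (le_of_eq ?_)
    rw [norm_smul, norm_smul, Real.norm_of_nonneg (by push_cast; linarith),
      Real.norm_of_nonneg (by push_cast; linarith)]
    push_cast
    rw [add_assoc (i : ℤ)]
    ring
  refine (Real.rpow_le_rpow (norm_nonneg _) h5 (by linarith)).trans ?_
  have := (convexOn_rpow hq).2 (Set.mem_Ici.2 (norm_nonneg (v (i + ⌊y⌋))))
    (Set.mem_Ici.2 (norm_nonneg (v (i + (⌊y⌋ + 1))))) h3 h4 (by ring)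
  simpa only [smul_eq_mul] using this

end Interp

/-! ### Summation of the memory term -/

/-- A backward shift of a nonnegative sequence drops terms at the top end and adds only terms of
negative index. -/
theorem sum_range_shift_le {a : ℤ → ℝ} (ha : ∀ i, 0 ≤ a i) (j : ℕ) {m : ℤ} (hm : m ≤ 0) :
    ∑ i ∈ Finset.range j, a (i + m) ≤ ∑ i ∈ Finset.range j, a i
      + ∑ i ∈ Finset.range j, if (i : ℤ) + m < 0 then a (i + m) else 0 := by
  obtain ⟨s, rfl⟩ : ∃ s : ℕ, m = -(s : ℤ) := ⟨m.natAbs, by omega⟩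
  have h1 : ∀ j : ℕ, ∑ i ∈ Finset.range j, (if (i : ℤ) + -(s : ℤ) < 0 then 0 else a (i + -(s : ℤ)))
      = ∑ i ∈ Finset.range (j - s), a i := by
    intro j
    induction j with
    | zero => simp
    | succ j ih =>
      rw [Finset.sum_range_succ, ih]
      split_ifs with h
      · rw [show j + 1 - s = j - s by omega, add_zero]
      · rw [show j + 1 - s = (j - s) + 1 by omega, Finset.sum_range_succ]
        congr 2
        omega
  have h2 : ∑ i ∈ Finset.range (j - s), a i ≤ ∑ i ∈ Finset.range j, a i :=
    Finset.sum_le_sum_of_subset_of_nonneg (Finset.range_mono (Nat.sub_le j s)) fun i _ _ => ha i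
  rw [← h1 j] at h2
  calc ∑ i ∈ Finset.range j, a (i + -(s : ℤ))
      = ∑ i ∈ Finset.range j, (if (i : ℤ) + -(s : ℤ) < 0 then 0 else a (i + -(s : ℤ)))
        + ∑ i ∈ Finset.range j, (if (i : ℤ) + -(s : ℤ) < 0 then a (i + -(s : ℤ)) else 0) := by
        rw [← Finset.sum_add_distrib]
        refine Finset.sum_congr rfl fun i _ => ?_
        split_ifs <;> simp
    _ ≤ _ := by gcongr

/-- The geometric series is summed with e^{-x} ≤ 1/(1+x). For x proportional to 1/l the result is of
order l, which the step size 1/l will compensate. -/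
theorem sum_exp_neg_mul_le {x : ℝ} (hx : 0 < x) (j : ℕ) :
    ∑ i ∈ Finset.range j, Real.exp (-(x * i)) ≤ 1 + 1 / x := by
  have h1 : ∀ i : ℕ, Real.exp (-(x * i)) = Real.exp (-x) ^ i := fun i => by
    rw [← Real.exp_nat_mul]; congr 1; ring
  simp only [h1]
  have h2 : Real.exp (-x) ≤ 1 / (1 + x) := by
    rw [Real.exp_neg, ← one_div]
    exact one_div_le_one_div_of_le (by linarith) (by linarith [Real.add_one_le_exp x])
  have h3 : x / (1 + x) ≤ 1 - Real.exp (-x) := by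
    have : x / (1 + x) = 1 - 1 / (1 + x) := by field_simp; ring
    linarith
  have h4 : 0 < x / (1 + x) := by positivity
  have h5 : (∑ i ∈ Finset.range j, Real.exp (-x) ^ i) * (1 - Real.exp (-x))
      = 1 - Real.exp (-x) ^ j := geom_sum_mul_neg _ j
  have h6 : 0 ≤ ∑ i ∈ Finset.range j, Real.exp (-x) ^ i :=
    Finset.sum_nonneg fun i _ => by positivity
  have h7 : (∑ i ∈ Finset.range j, Real.exp (-x) ^ i) * (x / (1 + x)) ≤ 1 := by
    have := mul_le_mul_of_nonneg_left h3 h6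
    have : 0 < Real.exp (-x) ^ j := by positivity
    linarith
  rw [← le_div_iff₀ h4] at h7
  refine h7.trans (le_of_eq ?_)
  field_simp
  ring

section Memory

variable {r : ℝ} (hr : 0 < r) {n : ℕ} (k : ℕ) {l : ℕ} (hl : 1 ≤ l) {v : ℤ → Vec n} {K q : ℝ}

include hr hl in
-- The negative-index terms grow at most like e^{-rt} in the time t. They split into e^{-qrm/l}, to
-- be integrated against the measure, and a geometric series in i whose sum is of order l.
theorem sum_norm_rpow_shift_le (hK : 0 ≤ K) (hq : 1 ≤ q)
    (hv : ∀ i : ℤ, i ≤ 0 → ‖v i‖ ≤ K * Real.exp (-(r * (i / l)))) (j : ℕ) {m : ℤ} (hm : m ≤ 0) :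
    ∑ i ∈ Finset.range j, ‖v (i + m)‖ ^ q ≤ ∑ i ∈ Finset.range j, ‖v i‖ ^ q
      + K ^ q * (l * (1 + 1 / (q * r))) * Real.exp (-(q * r * (m / l))) := by
  have hl0 : (0 : ℝ) < l := by exact_mod_cast hl
  have hl1 : (1 : ℝ) ≤ l := by exact_mod_cast hl
  have hx : 0 < q * r / l := by positivity
  refine (sum_range_shift_le (a := fun i => ‖v i‖ ^ q) (fun i => by positivity) j hm).trans ?_
  gcongr
  calc ∑ i ∈ Finset.range j, (if (i : ℤ) + m < 0 then ‖v (i + m)‖ ^ q else 0)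
      ≤ ∑ i ∈ Finset.range j, K ^ q * Real.exp (-(q * r * (m / l)))
          * Real.exp (-(q * r / l * i)) := by
        refine Finset.sum_le_sum fun i _ => ?_
        split_ifs with h
        · refine (Real.rpow_le_rpow (norm_nonneg _) (hv _ h.le) (by linarith)).trans
            (le_of_eq ?_)
          rw [Real.mul_rpow hK (Real.exp_pos _).le, ← Real.exp_mul, mul_assoc, ← Real.exp_add]
          congr 2
          push_cast
          field_simp
          ring
        · positivity
    _ = K ^ q * Real.exp (-(q * r * (m / l)))
          * ∑ i ∈ Finset.range j, Real.exp (-(q * r / l * i)) := by rw [Finset.mul_sum]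
    _ ≤ K ^ q * Real.exp (-(q * r * (m / l))) * (1 + 1 / (q * r / l)) := by
        gcongr
        exact sum_exp_neg_mul_le hx j
    _ ≤ K ^ q * Real.exp (-(q * r * (m / l))) * (l * (1 + 1 / (q * r))) := by
        gcongr
        have : 1 / (q * r / l) = l * (1 / (q * r)) := by field_simp
        rw [this]
        linarith
    _ = _ := by ring

include hr hl in
-- Interpolation averages two integer shifts of the sequence. Rounding y down moves the time by at
-- most 1/l ≤ 1, which costs the factor e^{qr}.
theorem sum_norm_interp_rpow_le (hK : 0 ≤ K) (hq : 1 ≤ q)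
    (hv : ∀ i : ℤ, i ≤ 0 → ‖v i‖ ≤ K * Real.exp (-(r * (i / l)))) (j : ℕ) {y : ℝ} (hy : y ≤ 0) :
    ∑ i ∈ Finset.range j, ‖interp v (i + y)‖ ^ q ≤ ∑ i ∈ Finset.range j, ‖v i‖ ^ q
      + K ^ q * (l * (1 + 1 / (q * r))) * (Real.exp (q * r) * Real.exp (-(q * r * (y / l)))) := by
  have hl0 : (0 : ℝ) < l := by exact_mod_cast hl
  have hl1 : (1 : ℝ) ≤ l := by exact_mod_cast hl
  have h3 : 0 ≤ (⌊y⌋ : ℝ) + 1 - y := by linarith [Int.lt_floor_add_one y]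
  have h4 : 0 ≤ y - ⌊y⌋ := by linarith [Int.floor_le y]
  have hfl : ⌊y⌋ ≤ 0 := by
    have := Int.floor_mono hy
    simpa using this
  set A := ∑ i ∈ Finset.range j, ‖v i‖ ^ q with hA
  set H := K ^ q * (l * (1 + 1 / (q * r))) * (Real.exp (q * r) * Real.exp (-(q * r * (y / l))))
    with hH
  have hbd : ∀ m : ℤ, m ≤ 0 → y - 1 ≤ m → ∑ i ∈ Finset.range j, ‖v (i + m)‖ ^ q ≤ A + H := by
    intro m hm hym
    refine (sum_norm_rpow_shift_le hr hl hK hq hv j hm).trans ?_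
    rw [hH, ← Real.exp_add]
    gcongr
    have h5 : (y - 1) / l ≤ m / l := by gcongr
    have h6 : y / l - 1 ≤ (y - 1) / l := by
      rw [sub_div]
      have : 1 / (l : ℝ) ≤ 1 := by rw [div_le_one hl0]; exact hl1
      linarith
    have h7 := mul_le_mul_of_nonneg_left (h6.trans h5) (by positivity : 0 ≤ q * r)
    linarith
  have h1 := hbd ⌊y⌋ hfl (by linarith)
  -- If ⌊y⌋ = 0 the upper node is a forward shift, outside the reach of `hbd`, but then its weight
  -- is zero.
  have h2 : (y - ⌊y⌋) * ∑ i ∈ Finset.range j, ‖v (i + (⌊y⌋ + 1))‖ ^ q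
      ≤ (y - ⌊y⌋) * (A + H) := by
    rcases hfl.lt_or_eq with h | h
    · exact mul_le_mul_of_nonneg_left (hbd _ (by omega) (by push_cast; linarith)) h4
    · have : y - ⌊y⌋ = 0 := by
        rw [h] at h4 ⊢
        push_cast at h4 ⊢
        linarith
      rw [this, zero_mul, zero_mul]
  calc ∑ i ∈ Finset.range j, ‖interp v (i + y)‖ ^ q
      ≤ ∑ i ∈ Finset.range j, (((⌊y⌋ : ℝ) + 1 - y) * ‖v (i + ⌊y⌋)‖ ^ q
      + (y - ⌊y⌋) * ‖v (i + (⌊y⌋ + 1))‖ ^ q) :=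
        Finset.sum_le_sum fun i _ => norm_interp_rpow_le v hq i y
    _ = ((⌊y⌋ : ℝ) + 1 - y) * ∑ i ∈ Finset.range j, ‖v (i + ⌊y⌋)‖ ^ q
      + (y - ⌊y⌋) * ∑ i ∈ Finset.range j, ‖v (i + (⌊y⌋ + 1))‖ ^ q := by
        rw [Finset.sum_add_distrib, Finset.mul_sum, Finset.mul_sum]
    _ ≤ ((⌊y⌋ : ℝ) + 1 - y) * (A + H) + (y - ⌊y⌋) * (A + H) :=
        add_le_add (mul_le_mul_of_nonneg_left h1 h3) h2
    _ = A + H := by ring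

theorem integrable_norm_evalAt_rpow {μ : Measure RMinus} (hq : 0 ≤ q)
    (hμ : MemExpMoment (q * r) μ) (φ : FadingSpace r n) :
    Integrable (fun u => ‖evalAt φ u‖ ^ q) μ := by
  have hc : Continuous fun u : RMinus => ‖evalAt φ u‖ ^ q := by
    have : Continuous fun u : RMinus => evalAt φ u := φ.1.continuous
    exact this.norm.rpow_const fun _ => Or.inr hq
  refine (hμ.integrable.const_mul (fadingNorm φ ^ q)).mono' hc.aestronglyMeasurable
    (.of_forall fun u => ?_)
  rw [Real.norm_of_nonneg (by positivity)]
  refine (Real.rpow_le_rpow (norm_nonneg _) (norm_evalAt_le φ u) hq).trans (le_of_eq ?_)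
  rw [Real.mul_rpow (fadingNorm_nonneg φ) (Real.exp_pos _).le, ← Real.exp_mul]
  congr 2
  ring

theorem evalAt_segment (v : ℤ → Vec n) (j : ℕ) (u : RMinus) :
    evalAt (segment hr k l v j) u = interp v ((j : ℝ) + max (u : ℝ) (-(k : ℝ)) * (l : ℝ)) := rfl

/-- The accumulated memory term is dominated by the accumulated instantaneous term, up to a
contribution of the initial values. -/
theorem sum_integral_segment_le (hl : 1 ≤ l) {μ : Measure RMinus} (hK : 0 ≤ K) (hq : 1 ≤ q)
    (hμ : MemExpMoment (q * r) μ)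
    (hv : ∀ i : ℤ, i ≤ 0 → ‖v i‖ ≤ K * Real.exp (-(r * (i / l)))) (j : ℕ) :
    ∑ i ∈ Finset.range j, ∫ u, ‖evalAt (segment hr k l v i) u‖ ^ q ∂μ
      ≤ ∑ i ∈ Finset.range j, ‖v i‖ ^ q
      + K ^ q * (l * (1 + 1 / (q * r))) *
        (Real.exp (q * r) * ∫ u : RMinus, Real.exp (-(q * r) * (u : ℝ)) ∂μ) := by
  have hl0 : (0 : ℝ) < l := by exact_mod_cast hl
  have := hμ.isProbabilityMeasure
  rw [← integral_finsetSum _ fun i _ => integrable_norm_evalAt_rpow (by linarith) hμ _]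
  have hint : Integrable (fun u : RMinus => ∑ i ∈ Finset.range j, ‖v i‖ ^ q
      + K ^ q * (l * (1 + 1 / (q * r))) *
        (Real.exp (q * r) * Real.exp (-(q * r) * (u : ℝ)))) μ :=
    (integrable_const _).add ((hμ.integrable.const_mul _).const_mul _)
  refine (integral_mono (integrable_finsetSum _ fun i _ =>
    integrable_norm_evalAt_rpow (by linarith) hμ _) hint fun u => ?_).trans (le_of_eq ?_)
  · have hmax : max (u : ℝ) (-(k : ℝ)) ≤ 0 := max_le u.2 (by simp)
    simp only [evalAt_segment]
    refine (sum_norm_interp_rpow_le hr hl hK hq hv j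
      (mul_nonpos_of_nonpos_of_nonneg hmax hl0.le)).trans ?_
    rw [mul_div_cancel_right₀ _ hl0.ne']
    gcongr
    -- Freezing the segment before −k can only decrease e^{-qru}; this makes the bound uniform in k.
    rw [← neg_mul]
    exact mul_le_mul_of_nonpos_left (le_max_left _ _) (by
      have : 0 < q * r := by positivity
      linarith)
  · rw [integral_add (integrable_const _) ((hμ.integrable.const_mul _).const_mul _),
      integral_const_mul, integral_const_mul]
    simp

end Memory

/-! ### Segments: norm bounds and dependence on the nodes -/

section Segment

variable {r : ℝ} (hr : 0 < r) {n : ℕ} (k : ℕ) {l : ℕ} {v : ℤ → Vec n}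

theorem atZero_segment (v : ℤ → Vec n) (j : ℕ) : atZero (segment hr k l v j) = v j := by
  change interp v ((j : ℝ) + max (0 : ℝ) (-(k : ℝ)) * (l : ℝ)) = v j
  rw [max_eq_left (by simp), zero_mul, add_zero, interp]
  simp

/-- Interpolation formally reads node j + 1 at the right endpoint, with weight zero. Erasing the
later nodes makes it visible that only the past matters. -/
theorem segment_cutoff (v : ℤ → Vec n) (j : ℕ) :
    segment hr k l v j = segment hr k l (fun i => if i ≤ j then v i else 0) j :=
  segment_congr hr k l j fun i hi => by simp [hi]

theorem fadingNorm_segment_le_of_forall {b : ℝ} (h : ∀ i, ‖v i‖ ≤ b) (j : ℕ) :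
    fadingNorm (segment hr k l v j) ≤ b := by
  refine fadingNorm_le fun u => ?_
  rw [evalAt_segment]
  have h1 : Real.exp (r * (u : ℝ)) ≤ 1 :=
    Real.exp_le_one_iff.2 (mul_nonpos_of_nonneg_of_nonpos hr.le u.2)
  exact (mul_le_of_le_one_left (norm_nonneg _) h1).trans (norm_interp_le (h _) (h _))

/-- At nonpositive times the growth e^{-rt} of the nodes is cancelled by the weight e^{ru}, up to
e^r for the rounding to the grid; at positive times the weight is at most 1. -/
theorem fadingNorm_segment_sq_le (hl : 1 ≤ l) {K s : ℝ} (hK : 0 ≤ K) (j : ℕ)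
    (hv : ∀ i : ℤ, i ≤ 0 → ‖v i‖ ≤ K * Real.exp (-(r * (i / l))))
    (hs : ∀ i : ℕ, i ≤ j → ‖v i‖ ^ 2 ≤ s) :
    fadingNorm (segment hr k l v j) ^ 2 ≤ K ^ 2 * Real.exp (2 * r) + s := by
  have hl0 : (0 : ℝ) < l := by exact_mod_cast hl
  have hl1 : (1 : ℝ) ≤ l := by exact_mod_cast hl
  have hs0 : 0 ≤ s := (by positivity : 0 ≤ ‖v ((0 : ℕ) : ℤ)‖ ^ 2).trans (hs 0 (Nat.zero_le j))
  set b := Real.sqrt (K ^ 2 * Real.exp (2 * r) + s) with hb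
  have hb2 : b ^ 2 = K ^ 2 * Real.exp (2 * r) + s := Real.sq_sqrt (by positivity)
  have hb0 : 0 ≤ b := Real.sqrt_nonneg _
  have hKb : K * Real.exp r ≤ b := by
    refine Real.le_sqrt_of_sq_le ?_
    rw [mul_pow, ← Real.exp_nat_mul]
    push_cast
    linarith
  rw [← hb2]
  refine pow_le_pow_left₀ (fadingNorm_nonneg _) ?_ 2
  rw [segment_cutoff]
  refine fadingNorm_le fun u => ?_
  rw [evalAt_segment]
  set x : ℝ := (j : ℝ) + max (u : ℝ) (-(k : ℝ)) * (l : ℝ) with hx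
  have hpos := Real.exp_pos (r * (u : ℝ))
  have hu1 : Real.exp (r * (u : ℝ)) ≤ 1 :=
    Real.exp_le_one_iff.2 (mul_nonpos_of_nonneg_of_nonpos hr.le u.2)
  have key : ∀ i : ℤ, x - 1 ≤ i →
      ‖if i ≤ (j : ℤ) then v i else 0‖ ≤ b / Real.exp (r * (u : ℝ)) := by
    intro i hi
    rw [le_div_iff₀ hpos]
    split_ifs with hij
    · rcases le_total i 0 with h0 | h0
      · refine (mul_le_mul_of_nonneg_right (hv i h0) hpos.le).trans (le_trans ?_ hKb)
        rw [mul_assoc, ← Real.exp_add]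
        gcongr
        have h1 : (u : ℝ) * l ≤ max (u : ℝ) (-(k : ℝ)) * l := by gcongr; exact le_max_left _ _
        have h2 : (u : ℝ) - 1 ≤ i / l := by
          rw [le_div_iff₀ hl0]
          have : (0 : ℝ) ≤ j := Nat.cast_nonneg j
          linarith
        have h3 := mul_le_mul_of_nonneg_left h2 hr.le
        linarith
      · obtain ⟨i, rfl⟩ := Int.eq_ofNat_of_zero_le h0
        have h1 : ‖v i‖ ≤ b := Real.le_sqrt_of_sq_le
          ((hs i (by exact_mod_cast hij)).trans (by
            have : 0 ≤ K ^ 2 * Real.exp (2 * r) := by positivity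
            linarith))
        exact (mul_le_of_le_one_right (norm_nonneg _) hu1).trans h1
    · simpa using hb0
  have h1 := norm_interp_le (v := fun i => if i ≤ (j : ℤ) then v i else 0) (key ⌊x⌋ (Int.sub_one_lt_floor x).le)
    (key (⌊x⌋ + 1) (by push_cast; linarith [Int.lt_floor_add_one x]))
  rwa [le_div_iff₀' hpos] at h1

/-- A crude bound, depending on k and l, that serves only to prove continuity in finitely many
nodes. The index j + 1 is there because `interp` reads the node after the floor. -/
theorem fadingNorm_segment_le_sum (v : ℤ → Vec n) (j : ℕ) :
    fadingNorm (segment hr k l v j) ≤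
      ∑ i ∈ Finset.Icc ((j : ℤ) - (k * l : ℕ)) (j + 1), ‖v i‖ := by
  refine fadingNorm_le fun u => ?_
  rw [evalAt_segment]
  set x : ℝ := (j : ℝ) + max (u : ℝ) (-(k : ℝ)) * (l : ℝ) with hx
  have hu1 : Real.exp (r * (u : ℝ)) ≤ 1 :=
    Real.exp_le_one_iff.2 (mul_nonpos_of_nonneg_of_nonpos hr.le u.2)
  have hl0 : (0 : ℝ) ≤ l := Nat.cast_nonneg l
  have hlow : ((((j : ℤ) - (k * l : ℕ) : ℤ)) : ℝ) ≤ x := by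
    have := mul_le_mul_of_nonneg_right (le_max_right (u : ℝ) (-(k : ℝ))) hl0
    push_cast
    linarith
  have hup : x ≤ (j : ℤ) := by
    have h1 : max (u : ℝ) (-(k : ℝ)) ≤ 0 := max_le u.2 (by simp)
    have := mul_nonpos_of_nonpos_of_nonneg h1 hl0
    push_cast
    linarith
  have h1 := Int.le_floor.2 hlow
  have h2 : ⌊x⌋ ≤ j := by
    have := Int.floor_mono hup
    rwa [Int.floor_intCast] at this
  have key : ∀ i ∈ Finset.Icc ((j : ℤ) - (k * l : ℕ)) (j + 1),
      ‖v i‖ ≤ ∑ i ∈ Finset.Icc ((j : ℤ) - (k * l : ℕ)) (j + 1), ‖v i‖ := fun i hi =>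
    Finset.single_le_sum (f := fun i => ‖v i‖) (fun _ _ => norm_nonneg _) hi
  refine (mul_le_of_le_one_left (norm_nonneg _) hu1).trans
    (norm_interp_le (key _ ?_) (key _ ?_)) <;> rw [Finset.mem_Icc] <;> omega

theorem segment_sub (v v' : ℤ → Vec n) (j : ℕ) :
    segment hr k l v j - segment hr k l v' j = segment hr k l (v - v') j := by
  apply Subtype.ext
  ext1 u
  exact (interp_sub v v' _).symm

/-- A locally Lipschitz functional of the segment depends continuously on the node values. -/
theorem continuous_comp_segment {E : Type*} [SeminormedAddCommGroup E] {F : FadingSpace r n → E}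
    (hF : ∀ R : ℝ, 0 < R → ∃ K : ℝ, 0 < K ∧ ∀ φ ψ : FadingSpace r n,
      fadingNorm φ ≤ R → fadingNorm ψ ≤ R → ‖F φ - F ψ‖ ≤ K * fadingNorm (φ - ψ)) (j : ℕ) :
    Continuous fun v : ℤ → Vec n => F (segment hr k l v j) := by
  rw [continuous_iff_continuousAt]
  intro v₀
  set I := Finset.Icc ((j : ℤ) - (k * l : ℕ)) (j + 1)
  have hlim : Tendsto (fun v : ℤ → Vec n => ∑ i ∈ I, ‖(v - v₀) i‖) (𝓝 v₀) (𝓝 0) := by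
    have hc : Continuous fun v : ℤ → Vec n => ∑ i ∈ I, ‖(v - v₀) i‖ := by
      simp only [Pi.sub_apply]
      fun_prop
    simpa using hc.tendsto v₀
  obtain ⟨K, -, hK⟩ := hF (fadingNorm (segment hr k l v₀ j) + 1)
    (by linarith [fadingNorm_nonneg (segment hr k l v₀ j)])
  rw [ContinuousAt, tendsto_iff_norm_sub_tendsto_zero]
  refine squeeze_zero' (.of_forall fun _ => norm_nonneg _) ?_ (by simpa using hlim.const_mul |K|)
  filter_upwards [hlim.eventually_le_const one_pos] with v hv
  have h1 : fadingNorm (segment hr k l v j - segment hr k l v₀ j) ≤ ∑ i ∈ I, ‖(v - v₀) i‖ := by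
    rw [segment_sub]
    exact fadingNorm_segment_le_sum hr k _ j
  have h2 := fadingNorm_le_add_sub (segment hr k l v j) (segment hr k l v₀ j)
  refine (hK _ _ (by linarith) (by linarith)).trans ?_
  exact (mul_le_mul_of_nonneg_right (le_abs_self K) (fadingNorm_nonneg _)).trans
    (mul_le_mul_of_nonneg_left h1 (abs_nonneg K))

/-- No σ-algebra on the phase space is needed: the functional is continuous in the node values, and
the cutoff at j restricts it to nodes already known. -/
theorem measurable_comp_segment {E : Type*} [SeminormedAddCommGroup E] [MeasurableSpace E]
    [BorelSpace E] {F : FadingSpace r n → E}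
    (hF : ∀ R : ℝ, 0 < R → ∃ K : ℝ, 0 < K ∧ ∀ φ ψ : FadingSpace r n,
      fadingNorm φ ≤ R → fadingNorm ψ ≤ R → ‖F φ - F ψ‖ ≤ K * fadingNorm (φ - ψ))
    {Ω : Type*} {m : MeasurableSpace Ω} {V : Ω → ℤ → Vec n} (j : ℕ)
    (hV : ∀ i : ℤ, i ≤ j → Measurable fun ω => V ω i) :
    Measurable fun ω => F (segment hr k l (V ω) j) := by
  have h1 : Measurable fun ω => fun i : ℤ => if i ≤ j then V ω i else 0 := by
    refine measurable_pi_lambda _ fun i => ?_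
    by_cases hi : i ≤ j
    · simpa [hi] using hV i hi
    · simp [hi]
  have h2 := (continuous_comp_segment hr k (l := l) hF j).measurable.comp h1
  convert h2 using 2 with ω
  rw [segment_cutoff]
  rfl

end Segment

/-! ### Truncation and growth of the drift -/

section Truncation

variable {n : ℕ}

theorem norm_truncate (M : ℝ≥0∞) (x : Vec n) :
    ‖truncate M x‖ = (min (ENNReal.ofReal ‖x‖) M).toReal := by
  rcases eq_or_ne x 0 with rfl | hx
  · simp [truncate]
  · rw [truncate, norm_smul, norm_smul, norm_inv, norm_norm, inv_mul_cancel₀ (norm_ne_zero_iff.2 hx),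
      mul_one, Real.norm_of_nonneg ENNReal.toReal_nonneg]

theorem norm_truncate_le (M : ℝ≥0∞) (x : Vec n) : ‖truncate M x‖ ≤ ‖x‖ := by
  rw [norm_truncate]
  exact ENNReal.toReal_le_of_le_ofReal (norm_nonneg x) (min_le_left _ _)

theorem ofReal_norm_truncate_le (M : ℝ≥0∞) (x : Vec n) : ENNReal.ofReal ‖truncate M x‖ ≤ M := by
  rw [norm_truncate, ENNReal.ofReal_toReal]
  · exact min_le_right _ _
  · exact ne_top_of_le_ne_top ENNReal.ofReal_ne_top (min_le_left _ _)

theorem measurable_truncate (M : ℝ≥0∞) : Measurable (truncate M : Vec n → Vec n) := by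
  unfold truncate
  have h1 : Measurable fun x : Vec n => (min (ENNReal.ofReal ‖x‖) M).toReal :=
    ((measurable_norm.ennreal_ofReal).min measurable_const).ennreal_toReal
  exact h1.smul (measurable_norm.inv.smul measurable_id)

variable {r : ℝ} {f : FadingSpace r n → Vec n} {Λ : ℝ≥0 → ℝ≥0}

theorem fadingNorm_sub_zero (φ : FadingSpace r n) : fadingNorm (φ - 0) = fadingNorm φ :=
  congrArg fadingNorm (sub_zero φ)

/-- On the ball of radius `Λ⁻¹(y)` the drift grows at most linearly, with constant `y`. -/
theorem norm_drift_sub_le (hfΛ : ∀ (R : ℝ≥0) (φ ψ : FadingSpace r n),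
      fadingNorm φ ≤ R → fadingNorm ψ ≤ R → ‖f φ - f ψ‖ ≤ Λ R * fadingNorm (φ - ψ))
    {y : ℝ} {φ : FadingSpace r n} (hφ : ENNReal.ofReal (fadingNorm φ) ≤ invFun Λ y) :
    ‖f φ - f 0‖ ≤ max y (Λ 0) * fadingNorm φ := by
  have hN := fadingNorm_nonneg φ
  set N : ℝ≥0 := ⟨fadingNorm φ, hN⟩
  have hNφ : (N : ℝ) = fadingNorm φ := rfl
  have h0 : fadingNorm (0 : FadingSpace r n) ≤ N := by rw [fadingNorm_zero]; exact N.2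
  -- For constant Λ the radius is infinite and y plays no role; this is the reason for the maximum
  -- with Λ(0).
  by_cases hc : ∀ R, Λ R = Λ 0
  · have h1 := hfΛ N φ 0 le_rfl h0
    rw [hc, fadingNorm_sub_zero] at h1
    exact h1.trans (mul_le_mul_of_nonneg_right (le_max_right _ _) hN)
  rcases hN.eq_or_lt with hz | hpos
  · have h1 := hfΛ 0 φ 0 (by rw [← hz]; simp) (by rw [fadingNorm_zero]; simp)
    rw [fadingNorm_sub_zero, ← hz] at h1
    rw [← hz]
    simpa using h1
  rw [invFun, if_neg hc] at hφ
  -- The supremum defining Λ⁻¹(y) need not be attained, so Λ may exceed y at the norm of φ itself.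
  -- The shrunken segment cφ with c < 1 lies in a ball where Λ ≤ y, and the error, at most Λ(N)(1 −
  -- c)N with N the norm of φ, vanishes as c → 1.
  have hscale : ∀ m : ℕ, ‖f φ - f 0‖ ≤
      Λ N * (1 / ((m : ℝ) + 1) * fadingNorm φ) + y * fadingNorm φ := by
    intro m
    set c : ℝ := 1 - 1 / ((m : ℝ) + 1) with hc
    have hm : 0 < 1 / ((m : ℝ) + 1) := by positivity
    have hm1 : 1 / ((m : ℝ) + 1) ≤ 1 := by
      rw [div_le_one (by positivity)]
      have : (0 : ℝ) ≤ m := Nat.cast_nonneg m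
      linarith
    have hc0 : 0 ≤ c := by linarith
    have hc1 : c < 1 := by linarith
    have hcN : fadingNorm (c • φ) = c * fadingNorm φ := by
      rw [fadingNorm_smul, abs_of_nonneg hc0]
    have hlt : ENNReal.ofReal (c * fadingNorm φ) < ENNReal.ofReal (fadingNorm φ) :=
      (ENNReal.ofReal_lt_ofReal_iff hpos).2 (by nlinarith)
    obtain ⟨R, hR⟩ := lt_iSup_iff.1 (hlt.trans_le hφ)
    obtain ⟨hRy, hR⟩ := lt_iSup_iff.1 hR
    have hR' : c * fadingNorm φ ≤ R := by
      rw [← ENNReal.ofReal_coe_nnreal] at hR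
      exact ((ENNReal.ofReal_lt_ofReal_iff_of_nonneg (by positivity)).1 hR).le
    have h1 := hfΛ R (c • φ) 0 (hcN.le.trans hR') (by rw [fadingNorm_zero]; exact R.2)
    rw [fadingNorm_sub_zero, hcN] at h1
    have h2 := hfΛ N φ (c • φ) le_rfl (by rw [hcN, hNφ]; nlinarith)
    have h3 : fadingNorm (φ - c • φ) = 1 / ((m : ℝ) + 1) * fadingNorm φ := by
      have : φ - c • φ = (1 / ((m : ℝ) + 1)) • φ := by rw [hc]; module
      rw [this, fadingNorm_smul, abs_of_pos hm]
    rw [h3] at h2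
    have h4 : (Λ R : ℝ) * (c * fadingNorm φ) ≤ y * fadingNorm φ := by
      have hy : 0 ≤ y := (Λ R).2.trans hRy
      exact mul_le_mul hRy (by nlinarith) (by positivity) hy
    calc ‖f φ - f 0‖ = ‖(f φ - f (c • φ)) + (f (c • φ) - f 0)‖ := by congr 1; abel
      _ ≤ _ := (norm_add_le _ _).trans (add_le_add h2 (h1.trans h4))
  have hlim : Tendsto (fun m : ℕ => Λ N * (1 / ((m : ℝ) + 1) * fadingNorm φ) + y * fadingNorm φ)
      atTop (𝓝 (y * fadingNorm φ)) := by
    have := ((tendsto_one_div_add_atTop_nhds_zero_nat (𝕜 := ℝ)).mul_const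
      (fadingNorm φ)).const_mul (Λ N : ℝ)
    simpa using this.add_const (y * fadingNorm φ)
  exact (ge_of_tendsto' hlim hscale).trans
    (mul_le_mul_of_nonneg_right (le_max_left _ _) hN)

variable (f Λ) in
/-- The constant in the growth bound of the drift along the truncated scheme. -/
noncomputable def driftConst : ℝ := max (max 1 ‖f 0‖) (Λ 0)

theorem one_le_driftConst : 1 ≤ driftConst f Λ := (le_max_left _ _).trans (le_max_left _ _)

/-- Inside the truncation ball the drift grows linearly with a constant of order h^{-θ}, and
h·h^{-θ} ≤ h^{1/2} since θ ≤ 1/2 and h ≤ 1. The squared drift increment is therefore of first order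
in h. -/
theorem sq_mul_norm_drift_le (hfΛ : ∀ (R : ℝ≥0) (φ ψ : FadingSpace r n),
      fadingNorm φ ≤ R → fadingNorm ψ ≤ R → ‖f φ - f ψ‖ ≤ Λ R * fadingNorm (φ - ψ))
    {θ h : ℝ} (hθ0 : 0 < θ) (hθ : θ ≤ 1 / 2) (hh : 0 < h) (hh1 : h ≤ 1) {φ : FadingSpace r n}
    (hφ : ENNReal.ofReal (fadingNorm φ) ≤ invFun Λ (max 1 ‖f 0‖ * h ^ (-θ))) :
    (h * ‖f φ‖) ^ 2 ≤ 2 * driftConst f Λ ^ 2 * h * (1 + fadingNorm φ ^ 2) := by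
  have h1 := norm_drift_sub_le hfΛ hφ
  have hN := fadingNorm_nonneg φ
  set L := driftConst f Λ with hL
  have hL1 : 1 ≤ L := one_le_driftConst
  have hp1 : 1 ≤ h ^ (-θ) := Real.one_le_rpow_of_pos_of_le_one_of_nonpos hh hh1 (by linarith)
  have hLp : L ≤ L * h ^ (-θ) := le_mul_of_one_le_right (by linarith) hp1
  have hmax : max (max 1 ‖f 0‖ * h ^ (-θ)) (Λ 0 : ℝ) ≤ L * h ^ (-θ) := by
    refine max_le (mul_le_mul_of_nonneg_right (le_max_left _ _) (by positivity)) ?_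
    exact (le_max_right _ _).trans hLp
  have hf0 : ‖f 0‖ ≤ L * h ^ (-θ) :=
    ((le_max_right _ _).trans (le_max_left _ _)).trans hLp
  have h2 : ‖f φ‖ ≤ L * h ^ (-θ) * (1 + fadingNorm φ) := by
    have h3 : ‖f φ‖ ≤ ‖f 0‖ + ‖f φ - f 0‖ := by
      simpa using norm_add_le (f 0) (f φ - f 0)
    have h4 := h1.trans (mul_le_mul_of_nonneg_right hmax hN)
    linarith
  have h5 : h * h ^ (-θ) ≤ h ^ (1 / 2 : ℝ) := by
    have : h * h ^ (-θ) = h ^ (1 - θ) := by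
      rw [sub_eq_add_neg, Real.rpow_add hh, Real.rpow_one]
    rw [this]
    exact Real.rpow_le_rpow_of_exponent_ge hh hh1 (by linarith)
  have h6 : (h ^ (1 / 2 : ℝ)) ^ 2 = h := by
    rw [← Real.rpow_natCast, ← Real.rpow_mul hh.le]
    norm_num
  have h7 : h * ‖f φ‖ ≤ L * h ^ (1 / 2 : ℝ) * (1 + fadingNorm φ) := by
    calc h * ‖f φ‖ ≤ h * (L * h ^ (-θ) * (1 + fadingNorm φ)) := by gcongr
      _ = L * (h * h ^ (-θ)) * (1 + fadingNorm φ) := by ring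
      _ ≤ _ := by gcongr
  calc (h * ‖f φ‖) ^ 2 ≤ (L * h ^ (1 / 2 : ℝ) * (1 + fadingNorm φ)) ^ 2 := by gcongr
    _ = L ^ 2 * h * (1 + fadingNorm φ) ^ 2 := by rw [mul_pow, mul_pow, h6]
    _ ≤ L ^ 2 * h * (2 * (1 + fadingNorm φ ^ 2)) := by
      gcongr
      nlinarith [sq_nonneg (1 - fadingNorm φ)]
    _ = _ := by ring

end Truncation

/-! ### Frobenius norm -/

section Matrix

variable {n d : ℕ}

theorem abs_entry_le_matNorm (A : Matrix (Fin n) (Fin d) ℝ) (i : Fin n) (j : Fin d) :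
    |A i j| ≤ matNorm A := by
  refine Real.le_sqrt_of_sq_le ?_
  rw [sq_abs]
  exact (Finset.single_le_sum (f := fun j => A i j ^ 2) (fun _ _ => sq_nonneg _)
    (Finset.mem_univ j)).trans (Finset.single_le_sum (f := fun i => ∑ j, A i j ^ 2)
      (fun _ _ => Finset.sum_nonneg fun _ _ => sq_nonneg _) (Finset.mem_univ i))

theorem norm_mulVec_le (A : Matrix (Fin n) (Fin d) ℝ) (x : Vec d) :
    ‖(WithLp.toLp 2 (A.mulVec x.ofLp) : Vec n)‖ ≤ matNorm A * ‖x‖ := by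
  rw [EuclideanSpace.norm_eq, EuclideanSpace.norm_eq, matNorm, ← Real.sqrt_mul (by positivity)]
  refine Real.sqrt_le_sqrt ?_
  rw [Finset.sum_mul]
  refine Finset.sum_le_sum fun i _ => ?_
  simp only [Real.norm_eq_abs, sq_abs]
  exact Finset.sum_mul_sq_le_sq_mul_sq Finset.univ (fun c => A i c) (fun c => x c)

end Matrix

/-! ### Pathwise estimates and comparison with the majorant -/

section Pathwise

variable {r : ℝ} (hr : 0 < r) {n d : ℕ} (f : FadingSpace r n → Vec n)
  (g : FadingSpace r n → Matrix (Fin n) (Fin d) ℝ) (Λ : ℝ≥0 → ℝ≥0) (θ : ℝ)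
  (ξ : FadingSpace r n) (k l : ℕ) (w : ℝ≥0 → Vec d)

theorem norm_nodeX_of_nonpos_le {i : ℤ} (hi : i ≤ 0) :
    ‖nodeX hr f g Λ θ ξ k l w i‖ ≤ fadingNorm ξ * Real.exp (-(r * (i / l))) := by
  rw [nodeX, nodeY_of_nonpos hr f g Λ θ ξ k l w hi]
  refine (norm_truncate_le _ _).trans ((norm_evalAt_le ξ _).trans (le_of_eq ?_))
  have : (i : ℝ) / l ≤ 0 :=
    div_nonpos_of_nonpos_of_nonneg (by exact_mod_cast hi) (Nat.cast_nonneg l)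
  simp [gridTime, min_eq_left this]

/-- All nodes are truncated, the initial ones included; interpolation and the weight e^{ru} ≤ 1 do
not leave the ball. -/
theorem ofReal_fadingNorm_nodeSegment_le (j : ℕ) :
    ENNReal.ofReal (fadingNorm (nodeSegment hr f g Λ θ ξ k l w j)) ≤
      invFun Λ (max 1 ‖f 0‖ * (1 / (l : ℝ)) ^ (-θ)) := by
  set M := invFun Λ (max 1 ‖f 0‖ * (1 / (l : ℝ)) ^ (-θ)) with hM
  rcases eq_or_ne M ⊤ with h | h
  · rw [h]; exact le_top
  · rw [ENNReal.ofReal_le_iff_le_toReal h]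
    refine fadingNorm_segment_le_of_forall hr k (fun i => ?_) j
    rw [← ENNReal.ofReal_le_iff_le_toReal h]
    exact ofReal_norm_truncate_le M _

/-- The linear functional of the Brownian increment in the expansion of `|Y(t_{j+1})|²`. -/
noncomputable def stepNoise (j : ℕ) (v : Vec d) : ℝ :=
  2 * inner ℝ (nodeX hr f g Λ θ ξ k l w j
      + (1 / (l : ℝ)) • f (nodeSegment hr f g Λ θ ξ k l w j))
    (WithLp.toLp 2 ((g (nodeSegment hr f g Λ θ ξ k l w j)).mulVec v.ofLp))

/-- Splitting by coordinates writes the noise as past-measurable coefficients times centred scalar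
increments. -/
theorem stepNoise_eq_sum (j : ℕ) (v : Vec d) : stepNoise hr f g Λ θ ξ k l w j v =
    ∑ c, stepNoise hr f g Λ θ ξ k l w j (EuclideanSpace.single c 1) * v c := by
  set A := g (nodeSegment hr f g Λ θ ξ k l w j) with hA
  have h1 : (WithLp.toLp 2 (A.mulVec v.ofLp) : Vec n) = ∑ c, v c •
      (WithLp.toLp 2 (A.mulVec (EuclideanSpace.single c (1 : ℝ) : Vec d).ofLp) : Vec n) := by
    ext i
    simp [Matrix.mulVec, dotProduct, mul_comm]
  simp only [stepNoise, ← hA]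
  rw [h1, inner_sum, Finset.mul_sum]
  refine Finset.sum_congr rfl fun c _ => ?_
  rw [inner_smul_right]
  ring

variable {f g Λ θ} {a₁ a₂ q : ℝ} {μ : Measure RMinus}

/-- The standing assumptions of the pathwise estimates. -/
structure PathwiseAssumptions (f : FadingSpace r n → Vec n)
    (g : FadingSpace r n → Matrix (Fin n) (Fin d) ℝ) (Λ : ℝ≥0 → ℝ≥0) (θ a₁ a₂ q : ℝ)
    (μ : Measure RMinus) : Prop where
  growth : KhasminskiiGrowth f g a₁ a₂ q μ
  lipschitz : ∀ (R : ℝ≥0) (φ ψ : FadingSpace r n),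
      fadingNorm φ ≤ R → fadingNorm ψ ≤ R → ‖f φ - f ψ‖ ≤ Λ R * fadingNorm (φ - ψ)
  pos : 0 < θ
  le_half : θ ≤ 1 / 2

variable (r q a₂ μ) in
/-- The starting value of the majorant. -/
noncomputable def initBound (ξ : FadingSpace r n) : ℝ :=
  1 + fadingNorm ξ ^ 2 * Real.exp (2 * r) + 2 * a₂ * (fadingNorm ξ ^ q * (1 + 1 / (q * r)) *
        (Real.exp (q * r) * ∫ u : RMinus, Real.exp (-(q * r) * (u : ℝ)) ∂μ))

variable (hA : PathwiseAssumptions f g Λ θ a₁ a₂ q μ) {l : ℕ} (hl : 1 ≤ l)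

include hA hl

theorem sq_norm_nodeSegment_drift_le (j : ℕ) :
    ‖(1 / (l : ℝ)) • f (nodeSegment hr f g Λ θ ξ k l w j)‖ ^ 2 ≤ 2 * driftConst f Λ ^ 2 *
      (1 / (l : ℝ)) * (1 + fadingNorm (nodeSegment hr f g Λ θ ξ k l w j) ^ 2) := by
  have hl0 : (0 : ℝ) < l := by exact_mod_cast hl
  have hl1 : (1 : ℝ) ≤ l := by exact_mod_cast hl
  have := sq_mul_norm_drift_le hA.lipschitz hA.pos hA.le_half (by positivity : 0 < 1 / (l : ℝ))
    (by rw [div_le_one hl0]; exact hl1)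
    (ofReal_fadingNorm_nodeSegment_le hr f g Λ θ ξ k l w j)
  rwa [norm_smul, Real.norm_of_nonneg (by positivity)]

/-- Both factors of the inner product grow linearly in the segment, so the noise is of the same
quadratic order as |X|². This multiplicative structure is what the majorant needs. -/
theorem abs_stepNoise_le (j : ℕ) (v : Vec d) : |stepNoise hr f g Λ θ ξ k l w j v| ≤
    2 * (1 + 2 * driftConst f Λ) * Real.sqrt a₁ *
      (1 + fadingNorm (nodeSegment hr f g Λ θ ξ k l w j) ^ 2) * ‖v‖ := by
  have hl0 : (0 : ℝ) < l := by exact_mod_cast hl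
  have hl1 : (1 : ℝ) ≤ l := by exact_mod_cast hl
  have h1l : 1 / (l : ℝ) ≤ 1 := by rw [div_le_one hl0]; exact hl1
  have hdr := sq_norm_nodeSegment_drift_le hr ξ k w hA hl j
  set φ := nodeSegment hr f g Λ θ ξ k l w j with hφ
  have hx : ‖nodeX hr f g Λ θ ξ k l w j‖ ≤ fadingNorm φ := by
    have := norm_atZero_le φ
    rwa [hφ, nodeSegment, atZero_segment] at this
  have hN := fadingNorm_nonneg φ
  have hL : 1 ≤ driftConst f Λ := one_le_driftConst
  set s := Real.sqrt (1 + fadingNorm φ ^ 2) with hs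
  have hs2 : s ^ 2 = 1 + fadingNorm φ ^ 2 := Real.sq_sqrt (by positivity)
  have hs0 : 0 ≤ s := Real.sqrt_nonneg _
  have hNs : fadingNorm φ ≤ s := Real.le_sqrt_of_sq_le (by linarith)
  have hf : ‖(1 / (l : ℝ)) • f φ‖ ≤ 2 * driftConst f Λ * s := by
    refine le_of_sq_le_sq ?_ (by positivity)
    rw [mul_pow, hs2]
    refine hdr.trans ?_
    have : 2 * driftConst f Λ ^ 2 * (1 / (l : ℝ)) ≤ (2 * driftConst f Λ) ^ 2 := by
      have := mul_le_mul_of_nonneg_left h1l (by positivity : 0 ≤ 2 * driftConst f Λ ^ 2)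
      nlinarith [sq_nonneg (driftConst f Λ)]
    exact mul_le_mul_of_nonneg_right this (by positivity)
  have hg : matNorm (g φ) ≤ Real.sqrt a₁ * s := by
    refine le_of_sq_le_sq ?_ (by positivity)
    rw [mul_pow, hs2, Real.sq_sqrt hA.growth.a₁_pos.le]
    exact hA.growth.diffusion φ
  rw [stepNoise, abs_mul, abs_of_pos (by norm_num : (0 : ℝ) < 2)]
  have h1 := abs_real_inner_le_norm (nodeX hr f g Λ θ ξ k l w j + (1 / (l : ℝ)) • f φ)
    (WithLp.toLp 2 ((g φ).mulVec v.ofLp))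
  have h2 : ‖nodeX hr f g Λ θ ξ k l w j + (1 / (l : ℝ)) • f φ‖
      ≤ (1 + 2 * driftConst f Λ) * s := by
    refine (norm_add_le _ _).trans ?_
    linarith [hx.trans hNs]
  have h3 : ‖(WithLp.toLp 2 ((g φ).mulVec v.ofLp) : Vec n)‖ ≤ Real.sqrt a₁ * s * ‖v‖ :=
    (norm_mulVec_le _ _).trans (mul_le_mul_of_nonneg_right hg (norm_nonneg v))
  have h4 := h1.trans (mul_le_mul h2 h3 (norm_nonneg _) (by positivity))
  rw [← hs2]
  linarith

/-- Truncation does not increase the norm, so |Y|² may be expanded instead. The cross term with f is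
handled by the Khasminskii condition, and the a₂ part is kept as it stands, since only its sum over
the steps is controlled. -/
theorem norm_sq_nodeX_succ_le (j : ℕ) :
    ‖nodeX hr f g Λ θ ξ k l w ((j : ℤ) + 1)‖ ^ 2 ≤ ‖nodeX hr f g Λ θ ξ k l w j‖ ^ 2
      + ((2 * a₁ + 2 * driftConst f Λ ^ 2) * (1 / (l : ℝ)) + a₁ * ‖increment w l j‖ ^ 2)
        * (1 + fadingNorm (nodeSegment hr f g Λ θ ξ k l w j) ^ 2)
      + stepNoise hr f g Λ θ ξ k l w j (increment w l j)
      + 2 * a₂ * (1 / (l : ℝ)) * (∫ u, ‖evalAt (nodeSegment hr f g Λ θ ξ k l w j) u‖ ^ q ∂μ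
        - ‖nodeX hr f g Λ θ ξ k l w j‖ ^ q) := by
  have hl0 : (0 : ℝ) < l := by exact_mod_cast hl
  have hdr := sq_norm_nodeSegment_drift_le hr ξ k w hA hl j
  have hY := nodeY_succ hr f g Λ θ ξ k l w j
  have hX : ‖nodeX hr f g Λ θ ξ k l w ((j : ℤ) + 1)‖ ≤ ‖nodeY hr f g Λ θ ξ k l w ((j : ℤ) + 1)‖ :=
    norm_truncate_le _ _
  have hD : stepNoise hr f g Λ θ ξ k l w j (increment w l j) = 2 * inner ℝ
    (nodeX hr f g Λ θ ξ k l w j + (1 / (l : ℝ)) • f (nodeSegment hr f g Λ θ ξ k l w j))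
    (WithLp.toLp 2 ((g (nodeSegment hr f g Λ θ ξ k l w j)).mulVec (increment w l j).ofLp)) := rfl
  have h0 : atZero (nodeSegment hr f g Λ θ ξ k l w j) = nodeX hr f g Λ θ ξ k l w j :=
    atZero_segment hr k _ j
  have hdrift := hA.growth.drift (nodeSegment hr f g Λ θ ξ k l w j)
  rw [h0] at hdrift
  have hdiff := hA.growth.diffusion (nodeSegment hr f g Λ θ ξ k l w j)
  set φ := nodeSegment hr f g Λ θ ξ k l w j with hφ
  set x := nodeX hr f g Λ θ ξ k l w j
  set η := increment w l j
  have hG : ‖(WithLp.toLp 2 ((g φ).mulVec η.ofLp) : Vec n)‖ ^ 2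
      ≤ a₁ * (1 + fadingNorm φ ^ 2) * ‖η‖ ^ 2 := by
    refine (pow_le_pow_left₀ (norm_nonneg _) (norm_mulVec_le (g φ) η) 2).trans ?_
    rw [mul_pow]
    exact mul_le_mul_of_nonneg_right hdiff (by positivity)
  have hsq := pow_le_pow_left₀ (norm_nonneg _) hX 2
  rw [hY, norm_add_sq_real, norm_add_sq_real, inner_smul_right, ← mul_assoc 2, ← hD] at hsq
  have hdr2 := mul_le_mul_of_nonneg_left hdrift (by positivity : 0 ≤ 2 * (1 / (l : ℝ)))
  linarith

/-- The contribution of the initial segment to the bound of the scheme. -/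
theorem sum_memory_le (j : ℕ) :
    ∑ i ∈ Finset.range j, 2 * a₂ * (1 / (l : ℝ)) *
      (∫ u, ‖evalAt (nodeSegment hr f g Λ θ ξ k l w i) u‖ ^ q ∂μ
        - ‖nodeX hr f g Λ θ ξ k l w i‖ ^ q)
      ≤ 2 * a₂ * (fadingNorm ξ ^ q * (1 + 1 / (q * r)) *
        (Real.exp (q * r) * ∫ u : RMinus, Real.exp (-(q * r) * (u : ℝ)) ∂μ)) := by
  have hl0 : (0 : ℝ) < l := by exact_mod_cast hl
  have h1 := sum_integral_segment_le hr k hl (fadingNorm_nonneg ξ)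
    (by linarith [hA.growth.two_lt_pbar]) hA.growth.memExpMoment
    (fun i hi => norm_nodeX_of_nonpos_le hr f g Λ θ ξ k l w hi) j
  rw [← Finset.mul_sum, Finset.sum_sub_distrib]
  have h2 := mul_le_mul_of_nonneg_left (sub_le_iff_le_add'.2 h1)
    (by have := hA.growth.a₂_nonneg; positivity : 0 ≤ 2 * a₂ * (1 / (l : ℝ)))
  refine h2.trans (le_of_eq ?_)
  field_simp

theorem norm_sq_nodeX_le (j : ℕ) :
    ‖nodeX hr f g Λ θ ξ k l w j‖ ^ 2 ≤ initBound r a₂ q μ ξ + ∑ i ∈ Finset.range j,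
      (((2 * a₁ + 2 * driftConst f Λ ^ 2) * (1 / (l : ℝ)) + a₁ * ‖increment w l i‖ ^ 2)
        * (1 + fadingNorm (nodeSegment hr f g Λ θ ξ k l w i) ^ 2)
      + stepNoise hr f g Λ θ ξ k l w i (increment w l i)) := by
  have h1 : ∀ j : ℕ, ‖nodeX hr f g Λ θ ξ k l w j‖ ^ 2 ≤ ‖nodeX hr f g Λ θ ξ k l w 0‖ ^ 2
      + ∑ i ∈ Finset.range j,
      (((2 * a₁ + 2 * driftConst f Λ ^ 2) * (1 / (l : ℝ)) + a₁ * ‖increment w l i‖ ^ 2)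
        * (1 + fadingNorm (nodeSegment hr f g Λ θ ξ k l w i) ^ 2)
      + stepNoise hr f g Λ θ ξ k l w i (increment w l i))
      + ∑ i ∈ Finset.range j, 2 * a₂ * (1 / (l : ℝ)) *
      (∫ u, ‖evalAt (nodeSegment hr f g Λ θ ξ k l w i) u‖ ^ q ∂μ
        - ‖nodeX hr f g Λ θ ξ k l w i‖ ^ q) := by
    intro j
    induction j with
    | zero => simp
    | succ j ih =>
      rw [Finset.sum_range_succ, Finset.sum_range_succ]
      have := norm_sq_nodeX_succ_le hr ξ k w hA hl j
      push_cast
      linarith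
  have h2 := sum_memory_le hr ξ k w hA hl j
  have h3 : ‖nodeX hr f g Λ θ ξ k l w 0‖ ^ 2 ≤ fadingNorm ξ ^ 2 * Real.exp (2 * r) := by
    have h4 := norm_nodeX_of_nonpos_le hr f g Λ θ ξ k l w le_rfl
    simp only [Int.cast_zero, zero_div, mul_zero, neg_zero, Real.exp_zero, mul_one] at h4
    refine (pow_le_pow_left₀ (norm_nonneg _) h4 2).trans ?_
    exact le_mul_of_one_le_right (by positivity) (Real.one_le_exp (by linarith))
  have h5 := h1 j
  rw [initBound]
  linarith

omit hl in
include hr in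
theorem initBound_ge : 1 + fadingNorm ξ ^ 2 * Real.exp (2 * r) ≤ initBound r a₂ q μ ξ := by
  have h1 : 0 ≤ ∫ u : RMinus, Real.exp (-(q * r) * (u : ℝ)) ∂μ :=
    integral_nonneg fun u => (Real.exp_pos _).le
  have h2 := hA.growth.a₂_nonneg
  have h3 : 0 < q := by linarith [hA.growth.two_lt_pbar]
  have h4 := fadingNorm_nonneg ξ
  rw [initBound]
  have : 0 ≤ 2 * a₂ * (fadingNorm ξ ^ q * (1 + 1 / (q * r)) *
        (Real.exp (q * r) * ∫ u : RMinus, Real.exp (-(q * r) * (u : ℝ)) ∂μ)) := by positivity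
  linarith

/-- The scheme is dominated by the majorant process. -/
theorem le_majorant (j : ℕ) :
    ‖nodeX hr f g Λ θ ξ k l w j‖ ^ 2 ≤ (majorant (initBound r a₂ q μ ξ)
        (fun i => stepNoise hr f g Λ θ ξ k l w i (increment w l i))
        (fun i => (4 * a₁ + 4 * driftConst f Λ ^ 2) *
          (1 / (l : ℝ) + ‖increment w l i‖ ^ 2)) j).1 ∧
      1 + fadingNorm (nodeSegment hr f g Λ θ ξ k l w j) ^ 2 ≤
        2 * (majorant (initBound r a₂ q μ ξ)
        (fun i => stepNoise hr f g Λ θ ξ k l w i (increment w l i))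
        (fun i => (4 * a₁ + 4 * driftConst f Λ ^ 2) *
          (1 / (l : ℝ) + ‖increment w l i‖ ^ 2)) j).2 := by
  have hl0 : (0 : ℝ) < l := by exact_mod_cast hl
  have ha := hA.growth.a₁_pos
  set z := initBound r a₂ q μ ξ with hz
  set δ : ℕ → ℝ := fun i => stepNoise hr f g Λ θ ξ k l w i (increment w l i) with hδ
  set e : ℕ → ℝ := fun i => (4 * a₁ + 4 * driftConst f Λ ^ 2) *
          (1 / (l : ℝ) + ‖increment w l i‖ ^ 2) with he
  induction j using Nat.strong_induction_on with
  | _ j ih =>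
    have h1 : ‖nodeX hr f g Λ θ ξ k l w j‖ ^ 2 ≤ (majorant z δ e j).1 := by
      rw [majorant_fst_eq_sum]
      refine (norm_sq_nodeX_le hr ξ k w hA hl j).trans ?_
      refine add_le_add le_rfl (Finset.sum_le_sum fun i hi => ?_)
      have h2 := (ih i (Finset.mem_range.1 hi)).2
      -- The constant in e is chosen so that the coefficient here is at most e/2, which offsets the
      -- factor 2 in 1 + ‖X_{t_i}‖_r² ≤ 2S_i.
      have h3 : (2 * a₁ + 2 * driftConst f Λ ^ 2) * (1 / (l : ℝ)) + a₁ * ‖increment w l i‖ ^ 2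
          ≤ e i / 2 := by
        have : 0 ≤ (a₁ + 2 * driftConst f Λ ^ 2) * ‖increment w l i‖ ^ 2 := by positivity
        simp only [he]
        linarith
      have h4 : 0 ≤ e i := by simp only [he]; positivity
      have h5 := mul_le_mul h3 h2 (by positivity) (by linarith)
      linarith
    refine ⟨h1, ?_⟩
    have h6 : ∀ i : ℕ, i ≤ j → ‖nodeX hr f g Λ θ ξ k l w i‖ ^ 2 ≤ (majorant z δ e j).2 := by
      intro i hi
      have h7 : ‖nodeX hr f g Λ θ ξ k l w i‖ ^ 2 ≤ (majorant z δ e i).1 := by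
        rcases hi.lt_or_eq with h | rfl
        · exact (ih i h).1
        · exact h1
      exact h7.trans ((majorant_fst_le_snd z δ e i).trans (majorant_snd_mono z δ e hi))
    have h8 := fadingNorm_segment_sq_le hr k hl (fadingNorm_nonneg ξ) j
      (fun i hi => norm_nodeX_of_nonpos_le hr f g Λ θ ξ k l w hi) h6
    -- The initial segment contributes at most z ≤ S_j and the later nodes at most S_j: this is the
    -- factor 2.
    have h9 := initBound_ge hr ξ hA
    have h10 := le_majorant_snd z δ e j
    rw [nodeSegment]
    linarith

end Pathwise

/-! ### Adaptedness of the scheme -/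

section Measurability

variable {r : ℝ} (hr : 0 < r) {n d : ℕ} {f : FadingSpace r n → Vec n}
  {g : FadingSpace r n → Matrix (Fin n) (Fin d) ℝ} (Λ : ℝ≥0 → ℝ≥0) (θ : ℝ)
  (ξ : FadingSpace r n) (k l : ℕ) (hf : DriftLocallyLipschitz f) (hg : DiffusionLocallyLipschitz g)
  {Ω : Type*} {w : Ω → ℝ≥0 → Vec d}

include hg in
theorem measurable_mulVec_segment {m : MeasurableSpace Ω} {V : Ω → ℤ → Vec n} {η : Ω → Vec d}
    (hη : Measurable η) (j : ℕ) (hV : ∀ i : ℤ, i ≤ j → Measurable fun ω => V ω i) :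
    Measurable fun ω => (WithLp.toLp 2 ((g (segment hr k l (V ω) j)).mulVec (η ω).ofLp) :
      Vec n) := by
  refine (WithLp.measurable_toLp 2 _).comp (measurable_pi_lambda _ fun a => ?_)
  simp only [Matrix.mulVec, dotProduct]
  refine Finset.measurable_sum _ fun b _ => Measurable.mul ?_ ?_
  · refine measurable_comp_segment hr k (F := fun φ => g φ a b) (fun R hR => ?_) j hV
    obtain ⟨K, hK, h⟩ := hg R hR
    exact ⟨K, hK, fun φ ψ hφ hψ =>
      (abs_entry_le_matNorm (g φ - g ψ) a b).trans (h φ ψ hφ hψ)⟩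
  · exact (measurable_pi_apply b).comp ((WithLp.measurable_ofLp 2 _).comp hη)

include hf hg in
theorem measurable_nodeX {ℱ : ℕ → MeasurableSpace Ω} (hmono : Monotone ℱ)
    (hη : ∀ j, Measurable[ℱ (j + 1)] fun ω => increment (w ω) l j) (j : ℕ) :
    ∀ i : ℤ, i ≤ j → Measurable[ℱ j] fun ω => nodeX hr f g Λ θ ξ k l (w ω) i := by
  induction j with
  | zero =>
    intro i hi
    simp only [nodeX, nodeY_of_nonpos hr f g Λ θ ξ k l _ (by simpa using hi : i ≤ 0)]
    exact measurable_const
  | succ j ih =>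
    intro i hi
    rcases eq_or_ne i ((j : ℤ) + 1) with rfl | h
    · have ih' : ∀ i : ℤ, i ≤ j →
          Measurable[ℱ (j + 1)] fun ω => nodeX hr f g Λ θ ξ k l (w ω) i :=
        fun i hi => (ih i hi).mono (hmono j.le_succ) le_rfl
      simp only [nodeX, nodeY_succ]
      refine (measurable_truncate _).comp (Measurable.add (Measurable.add ?_ ?_) ?_)
      · exact ih' j le_rfl
      · exact (measurable_comp_segment hr k hf j ih').const_smul (1 / (l : ℝ))
      · exact measurable_mulVec_segment hr k l hg (hη j) j ih'
    · exact (ih i (by push_cast at hi; omega)).mono (hmono j.le_succ) le_rfl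

include hf hg in
-- The vector η is kept separate from the path: with the increment it gives the noise at time j + 1,
-- with a fixed basis vector a coefficient measurable at time j.
theorem measurable_stepNoise {ℱ : ℕ → MeasurableSpace Ω} (hmono : Monotone ℱ)
    (hη : ∀ j, Measurable[ℱ (j + 1)] fun ω => increment (w ω) l j) (j : ℕ)
    {m : MeasurableSpace Ω} (hm : ℱ j ≤ m) {η : Ω → Vec d} (hηm : Measurable[m] η) :
    Measurable[m] fun ω => stepNoise hr f g Λ θ ξ k l (w ω) j (η ω) := by
  have h1 : ∀ i : ℤ, i ≤ j → Measurable[m] fun ω => nodeX hr f g Λ θ ξ k l (w ω) i :=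
    fun i hi => (measurable_nodeX hr Λ θ ξ k l hf hg hmono hη j i hi).mono hm le_rfl
  unfold stepNoise
  refine Measurable.const_mul (Measurable.inner (Measurable.add (h1 j le_rfl) ?_) ?_) 2
  · exact (measurable_comp_segment hr k hf j h1).const_smul (1 / (l : ℝ))
  · exact measurable_mulVec_segment hr k l hg hηm j h1

end Measurability

/-! ### Brownian increments: independence and moments -/

section Brownian

variable {Ω : Type*} {mΩ : MeasurableSpace Ω} {P : Measure Ω} {d : ℕ} {B : ℝ≥0 → Ω → Vec d}

theorem IsBrownianMotion.measurable_increment (hB : IsBrownianMotion B P) (l j : ℕ) :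
    Measurable fun ω => increment (fun s => B s ω) l j :=
  (hB.measurable _).sub (hB.measurable _)

theorem IsBrownianMotion.measurable_increment_apply (hB : IsBrownianMotion B P) (l j : ℕ)
    (c : Fin d) : Measurable fun ω => increment (fun s => B s ω) l j c :=
  (measurable_pi_apply c).comp ((WithLp.measurable_ofLp 2 _).comp (hB.measurable_increment l j))

/-- Independence of the coordinate paths and independence of the increments within each coordinate
combine into joint independence over all pairs. -/
theorem IsBrownianMotion.iIndepFun_increment (hB : IsBrownianMotion B P) (l : ℕ) :
    iIndepFun (fun (p : Fin d × ℕ) ω => increment (fun s => B s ω) l p.2 p.1) P := by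
  refine iIndepFun_uncurry' (X := fun (c : Fin d) (i : ℕ) ω => increment (fun s => B s ω) l i c)
    (fun c i => hB.measurable_increment_apply l i c) ?_ fun c => ?_
  · refine hB.indep.comp (fun _ (x : ℝ≥0 → ℝ) (i : ℕ) => x (((i : ℝ≥0) + 1) / l) - x ((i : ℝ≥0) / l))
      fun _ => ?_
    exact measurable_pi_lambda _ fun i => (measurable_pi_apply _).sub (measurable_pi_apply _)
  · have h := (hB.coord c).toIsPreBrownianReal.hasIndepIncrements.nat
      (t := fun i : ℕ => (i : ℝ≥0) / l) (fun i i' h => by dsimp only; gcongr)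
    simp only [Nat.cast_add, Nat.cast_one] at h
    exact h

variable (B) in
/-- The `σ`-algebra generated by the increments before the time `t_j`. -/
noncomputable abbrev pastIncrements (l j : ℕ) : MeasurableSpace Ω :=
  ⨆ p ∈ {p : Fin d × ℕ | p.2 < j}, MeasurableSpace.comap
    (fun ω => increment (fun s => B s ω) l p.2 p.1) inferInstance

theorem pastIncrements_mono (l : ℕ) : Monotone (pastIncrements B l) := fun _ _ h =>
  biSup_mono fun _ hp => lt_of_lt_of_le hp h

theorem IsBrownianMotion.pastIncrements_le (hB : IsBrownianMotion B P) (l j : ℕ) :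
    pastIncrements B l j ≤ mΩ :=
  iSup₂_le fun p _ => (hB.measurable_increment_apply l p.2 p.1).comap_le

theorem measurable_increment_of_apply {m : MeasurableSpace Ω} {l j : ℕ}
    (h : ∀ c : Fin d, MeasurableSpace.comap (fun ω => increment (fun s => B s ω) l j c)
      inferInstance ≤ m) : Measurable[m] fun ω => increment (fun s => B s ω) l j := by
  have h1 : Measurable[m] fun ω => (increment (fun s => B s ω) l j).ofLp :=
    measurable_pi_lambda _ fun c => measurable_iff_comap_le.2 (h c)
  exact (WithLp.measurable_toLp 2 _).comp h1

theorem measurable_pastIncrements_increment (l j : ℕ) :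
    Measurable[pastIncrements B l (j + 1)] fun ω => increment (fun s => B s ω) l j :=
  measurable_increment_of_apply fun c => le_iSup₂_of_le (c, j) (Nat.lt_succ_self j) le_rfl

theorem IsBrownianMotion.indep_pastIncrements (hB : IsBrownianMotion B P) (l j : ℕ) :
    Indep (pastIncrements B l j)
      (MeasurableSpace.comap (fun ω => increment (fun s => B s ω) l j) inferInstance) P := by
  have h := indep_iSup_of_disjoint
    (fun p : Fin d × ℕ => (hB.measurable_increment_apply l p.2 p.1).comap_le)
    (hB.iIndepFun_increment l).iIndep (S := {p | p.2 < j}) (T := {p | p.2 = j})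
    (Set.disjoint_left.2 fun p hp hp' => (ne_of_lt hp) hp')
  refine indep_of_indep_of_le_right h ?_
  exact (measurable_increment_of_apply fun c => le_iSup₂_of_le (c, j) rfl le_rfl).comap_le

theorem IsBrownianMotion.indep_pastIncrements_comp (hB : IsBrownianMotion B P) (l j : ℕ)
    {ψ : Vec d → ℝ} (hψ : Measurable ψ) :
    Indep (pastIncrements B l j) (MeasurableSpace.comap
      (fun ω => ψ (increment (fun s => B s ω) l j)) inferInstance) P :=
  indep_of_indep_of_le_right (hB.indep_pastIncrements l j)
    (hψ.comp (comap_measurable _)).comap_le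

theorem IsBrownianMotion.hasLaw_increment (hB : IsBrownianMotion B P) (l j : ℕ)
    (c : Fin d) :
    HasLaw (fun ω => increment (fun s => B s ω) l j c) (gaussianReal 0 (1 / l)) P := by
  have h := (hB.coord c).toIsPreBrownianReal.hasLaw_sub (((j : ℝ≥0) + 1) / l) ((j : ℝ≥0) / l)
  have h1 : nndist (((j : ℝ≥0) + 1) / l : ℝ≥0).1 ((j : ℝ≥0) / l : ℝ≥0).1 = 1 / (l : ℝ≥0) := by
    apply NNReal.eq
    rw [coe_nndist, Real.dist_eq]
    change |(((((j : ℝ≥0) + 1) / l : ℝ≥0) : ℝ)) - ((((j : ℝ≥0) / l : ℝ≥0)) : ℝ)| = _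
    push_cast
    rw [add_div, add_sub_cancel_left, abs_of_nonneg (by positivity)]
  rw [h1] at h
  exact h

theorem IsBrownianMotion.hasLaw_scaled_increment (hB : IsBrownianMotion B P) {l : ℕ}
    (hl : 1 ≤ l) (j : ℕ) (c : Fin d) :
    HasLaw (fun ω => Real.sqrt l * increment (fun s => B s ω) l j c) (gaussianReal 0 1) P := by
  have hl0 : (l : ℝ) ≠ 0 := by
    have : l ≠ 0 := by omega
    exact_mod_cast this
  refine ⟨((hB.measurable_increment_apply l j c).const_mul _).aemeasurable, ?_⟩
  have h1 := (hB.hasLaw_increment l j c).map_eq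
  have h2 : (fun ω => Real.sqrt l * increment (fun s => B s ω) l j c)
      = (fun x => Real.sqrt l * x) ∘ fun ω => increment (fun s => B s ω) l j c := rfl
  rw [h2, ← Measure.map_map (measurable_const_mul _) (hB.measurable_increment_apply l j c), h1,
    gaussianReal_map_const_mul]
  congr 1
  · simp
  · apply NNReal.eq
    push_cast
    rw [Real.sq_sqrt (Nat.cast_nonneg l)]
    field_simp

theorem integrable_abs_pow_gaussianReal (k : ℕ) :
    Integrable (fun x : ℝ => |x| ^ k) (gaussianReal 0 1) := by
  have h := (memLp_id_gaussianReal' (μ := 0) (v := 1) (k : ℝ≥0∞)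
    (ENNReal.natCast_ne_top k)).integrable_norm_pow'
  simpa using h

theorem IsBrownianMotion.integral_increment (hB : IsBrownianMotion B P) (l j : ℕ) (c : Fin d) :
    Integrable (fun ω => increment (fun s => B s ω) l j c) P ∧
      ∫ ω, increment (fun s => B s ω) l j c ∂P = 0 := by
  have h := hB.hasLaw_increment l j c
  refine ⟨?_, by rw [h.integral_eq, integral_id_gaussianReal]⟩
  have h1 : Integrable (fun x : ℝ => x) (gaussianReal 0 (1 / l)) :=
    memLp_one_iff_integrable.1 (memLp_id_gaussianReal' 1 ENNReal.one_ne_top)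
  rw [← h.map_eq] at h1
  exact h1.comp_aemeasurable h.aemeasurable

/-- The rescaled `ℓ¹`-size of an increment. -/
noncomputable def incrementSize (l : ℕ) (x : Vec d) : ℝ := ∑ c, |Real.sqrt l * x c|

theorem incrementSize_nonneg (l : ℕ) (x : Vec d) : 0 ≤ incrementSize l x :=
  Finset.sum_nonneg fun _ _ => abs_nonneg _

theorem measurable_incrementSize (l : ℕ) : Measurable (incrementSize l : Vec d → ℝ) := by
  unfold incrementSize
  fun_prop

theorem norm_le_incrementSize {l : ℕ} (hl : 1 ≤ l) (x : Vec d) :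
    ‖x‖ ≤ Real.sqrt (1 / l) * incrementSize l x := by
  have hl0 : (0 : ℝ) < l := by exact_mod_cast hl
  have h1 : Real.sqrt (1 / l) * incrementSize l x = ∑ c, |x c| := by
    rw [incrementSize, Finset.mul_sum]
    refine Finset.sum_congr rfl fun c _ => ?_
    rw [abs_mul, abs_of_nonneg (Real.sqrt_nonneg _), ← mul_assoc, ← Real.sqrt_mul (by positivity)]
    rw [one_div_mul_cancel hl0.ne', Real.sqrt_one, one_mul]
  rw [h1, EuclideanSpace.norm_eq]
  refine Real.sqrt_le_iff.2 ⟨by positivity, ?_⟩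
  exact Finset.sum_sq_le_sq_sum_of_nonneg fun _ _ => abs_nonneg _

/-- The moments of the rescaled increments are bounded uniformly in the step size. -/
theorem IsBrownianMotion.exists_moment_bound (hB : IsBrownianMotion B P) [IsProbabilityMeasure P]
    (k : ℕ) : ∃ M : ℝ, 0 ≤ M ∧ ∀ l : ℕ, 1 ≤ l → ∀ j : ℕ,
      Integrable (fun ω => (1 + incrementSize l (increment (fun s => B s ω) l j)) ^ k) P ∧
      ∫ ω, (1 + incrementSize l (increment (fun s => B s ω) l j)) ^ k ∂P ≤ M := by
  set G := ∫ x : ℝ, |x| ^ (k + 1) ∂gaussianReal 0 1 with hG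
  refine ⟨2 ^ k * (1 + (d : ℝ) ^ k * (d * G)), ?_, fun l hl j => ?_⟩
  · have : 0 ≤ G := integral_nonneg fun x => by positivity
    positivity
  have hle : ∀ x : Vec d, (1 + incrementSize l x) ^ k ≤
      2 ^ k * (1 + (d : ℝ) ^ k * ∑ c, |Real.sqrt l * x c| ^ (k + 1)) := by
    intro x
    have h0 := incrementSize_nonneg l x
    -- Raising the exponent to k + 1, harmless as the base is at least 1, fits the power-mean
    -- inequalities and avoids the case k = 0.
    have h1 : (1 + incrementSize l x) ^ k ≤ (1 + incrementSize l x) ^ (k + 1) :=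
      pow_le_pow_right₀ (by linarith) k.le_succ
    have h2 := add_pow_le zero_le_one h0 (k + 1)
    have h3 := pow_sum_le_card_mul_sum_pow (s := Finset.univ)
      (f := fun c => |Real.sqrt l * x c|) (fun _ _ => abs_nonneg _) k
    rw [Finset.card_univ, Fintype.card_fin] at h3
    rw [one_pow, Nat.add_sub_cancel] at h2
    refine h1.trans (h2.trans ?_)
    gcongr
    exact h3
  have hi : ∀ c, Integrable
      (fun ω => |Real.sqrt l * increment (fun s => B s ω) l j c| ^ (k + 1)) P ∧
      ∫ ω, |Real.sqrt l * increment (fun s => B s ω) l j c| ^ (k + 1) ∂P = G := by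
    intro c
    have h := hB.hasLaw_scaled_increment hl j c
    have h1 := integrable_abs_pow_gaussianReal (k + 1)
    refine ⟨?_, ?_⟩
    · rw [← h.map_eq] at h1
      exact h1.comp_aemeasurable h.aemeasurable
    · rw [hG, ← h.map_eq, integral_map h.aemeasurable
        (Continuous.aestronglyMeasurable (by fun_prop))]
  have hbi : Integrable (fun ω => 2 ^ k * (1 + (d : ℝ) ^ k *
      ∑ c, |Real.sqrt l * increment (fun s => B s ω) l j c| ^ (k + 1))) P :=
    ((integrable_const 1).add ((integrable_finsetSum _ fun c _ => (hi c).1).const_mul _)).const_mul _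
  have hint : Integrable
      (fun ω => (1 + incrementSize l (increment (fun s => B s ω) l j)) ^ k) P := by
    refine hbi.mono' ?_ (.of_forall fun ω => ?_)
    · exact ((((measurable_incrementSize l).comp (hB.measurable_increment l j)).const_add
        1).pow_const k).aestronglyMeasurable
    · have h0 := incrementSize_nonneg l (increment (fun s => B s ω) l j)
      rw [Real.norm_of_nonneg (by positivity)]
      exact hle _
  refine ⟨hint, (integral_mono hint hbi fun ω => hle _).trans (le_of_eq ?_)⟩
  rw [integral_const_mul, integral_add (integrable_const 1)
    ((integrable_finsetSum _ fun c _ => (hi c).1).const_mul _), integral_const_mul,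
    integral_finsetSum _ fun c _ => (hi c).1]
  rw [Finset.sum_congr rfl fun c _ => (hi c).2]
  simp

end Brownian

/-! ### Size of the noise in powers of the step -/

section NoiseSize

variable {d : ℕ} {cE cD : ℝ}

theorem drift_noise_le (hE : 0 ≤ cE) {l : ℕ} (hl : 1 ≤ l) (v : Vec d) :
    cE * (1 / (l : ℝ) + ‖v‖ ^ 2) ≤ 1 / (l : ℝ) * (cE * (1 + incrementSize l v) ^ 2) := by
  have h0 := incrementSize_nonneg l v
  have h1 := pow_le_pow_left₀ (norm_nonneg v) (norm_le_incrementSize hl v) 2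
  rw [mul_pow, Real.sq_sqrt (by positivity)] at h1
  have h2 : 1 / (l : ℝ) + ‖v‖ ^ 2 ≤ 1 / (l : ℝ) * (1 + incrementSize l v) ^ 2 := by
    have : 0 ≤ 1 / (l : ℝ) * (2 * incrementSize l v) := by positivity
    linarith
  have := mul_le_mul_of_nonneg_left h2 hE
  linarith

/-- Including the part linear in the increment, the noise is only of order √Δ; its square, which
governs the Taylor remainder, is of order Δ. -/
theorem total_noise_le (hE : 0 ≤ cE) (hD : 0 ≤ cD) {l : ℕ} (hl : 1 ≤ l) (v : Vec d) :
    cE * (1 / (l : ℝ) + ‖v‖ ^ 2) + cD * ‖v‖ ≤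
      Real.sqrt (1 / l) * ((cE + cD) * (1 + incrementSize l v) ^ 2) := by
  have hl0 : (0 : ℝ) < l := by exact_mod_cast hl
  have hl1 : (1 : ℝ) ≤ l := by exact_mod_cast hl
  have h0 := incrementSize_nonneg l v
  have h1l : 1 / (l : ℝ) ≤ 1 := by rw [div_le_one hl0]; exact hl1
  have h1 : 1 / (l : ℝ) ≤ Real.sqrt (1 / l) := by
    refine Real.le_sqrt_of_sq_le ?_
    have : 0 ≤ 1 / (l : ℝ) := by positivity
    nlinarith
  have h2 := drift_noise_le hE hl v
  have h3 := mul_le_mul_of_nonneg_right h1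
    (by positivity : 0 ≤ cE * (1 + incrementSize l v) ^ 2)
  have h4 : ‖v‖ ≤ Real.sqrt (1 / l) * (1 + incrementSize l v) ^ 2 := by
    refine (norm_le_incrementSize hl v).trans (mul_le_mul_of_nonneg_left ?_ (Real.sqrt_nonneg _))
    nlinarith
  have h5 := mul_le_mul_of_nonneg_left h4 hD
  linarith

variable {Ω : Type*} {mΩ : MeasurableSpace Ω} {P : Measure Ω} [IsProbabilityMeasure P]
  {B : ℝ≥0 → Ω → Vec d}

theorem IsBrownianMotion.integrable_one_add_noise_pow (hB : IsBrownianMotion B P)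
    (hE : 0 ≤ cE) (hD : 0 ≤ cD) {l : ℕ} (hl : 1 ≤ l) (j k : ℕ) :
    Integrable (fun ω => (1 + (cE * (1 / (l : ℝ) + ‖increment (fun s => B s ω) l j‖ ^ 2)
      + cD * ‖increment (fun s => B s ω) l j‖)) ^ k) P := by
  have hl0 : (0 : ℝ) < l := by exact_mod_cast hl
  have hl1 : (1 : ℝ) ≤ l := by exact_mod_cast hl
  obtain ⟨M, -, hM⟩ := hB.exists_moment_bound (2 * k)
  refine ((hM l hl j).1.const_mul ((1 + (cE + cD)) ^ k)).mono' ?_ (.of_forall fun ω => ?_)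
  · have h := (hB.measurable_increment l j).norm
    exact (((((h.pow_const 2).const_add _).const_mul _).add (h.const_mul _)).const_add
      1).pow_const k |>.aestronglyMeasurable
  · set v := increment (fun s => B s ω) l j
    have h0 := incrementSize_nonneg l v
    rw [Real.norm_of_nonneg (by positivity), pow_mul, ← mul_pow]
    refine pow_le_pow_left₀ (by positivity) ?_ k
    have h1 := total_noise_le hE hD hl v
    have h2 : Real.sqrt (1 / l) ≤ 1 := by
      rw [Real.sqrt_le_one]
      rw [div_le_one hl0]; exact hl1
    have h3 := mul_le_mul_of_nonneg_right h2
      (by positivity : 0 ≤ (cE + cD) * (1 + incrementSize l v) ^ 2)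
    nlinarith

/-- The first two orders of the noise are of the order of the step size. -/
theorem IsBrownianMotion.exists_noise_bound (hB : IsBrownianMotion B P)
    (hE : 0 ≤ cE) (hD : 0 ≤ cD) (m : ℕ) : ∃ κ : ℝ, 0 ≤ κ ∧ ∀ l : ℕ, 1 ≤ l → ∀ j : ℕ,
      ∫ ω, cE * (1 / (l : ℝ) + ‖increment (fun s => B s ω) l j‖ ^ 2) ∂P ≤ κ * (1 / l) ∧
      ∫ ω, ((1 + (cE * (1 / (l : ℝ) + ‖increment (fun s => B s ω) l j‖ ^ 2)
        + cD * ‖increment (fun s => B s ω) l j‖)) ^ (2 * m + 2) - 1 - (2 * m + 2) *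
        (cE * (1 / (l : ℝ) + ‖increment (fun s => B s ω) l j‖ ^ 2)
        + cD * ‖increment (fun s => B s ω) l j‖)) ∂P ≤ κ * (1 / l) := by
  obtain ⟨M₁, hM₁, h₁⟩ := hB.exists_moment_bound 2
  obtain ⟨M₂, hM₂, h₂⟩ := hB.exists_moment_bound (2 * (2 * m + 2))
  refine ⟨cE * M₁ + (1 + (cE + cD)) ^ (2 * m + 2) * M₂, by positivity, fun l hl j => ⟨?_, ?_⟩⟩
  · calc ∫ ω, cE * (1 / (l : ℝ) + ‖increment (fun s => B s ω) l j‖ ^ 2) ∂P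
        ≤ ∫ ω, 1 / (l : ℝ) * (cE * (1 + incrementSize l (increment (fun s => B s ω) l j)) ^ 2)
          ∂P := by
          refine integral_mono_of_nonneg (.of_forall fun ω => by positivity)
            (((h₁ l hl j).1.const_mul _).const_mul _) (.of_forall fun ω => ?_)
          exact drift_noise_le hE hl _
      _ ≤ 1 / (l : ℝ) * (cE * M₁) := by
          rw [integral_const_mul, integral_const_mul]
          have := (h₁ l hl j).2
          gcongr
      _ ≤ (cE * M₁ + (1 + (cE + cD)) ^ (2 * m + 2) * M₂) * (1 / l) := by
          rw [mul_comm]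
          gcongr
          have : 0 ≤ (1 + (cE + cD)) ^ (2 * m + 2) * M₂ := by positivity
          linarith
  · have hl0 : (0 : ℝ) < l := by exact_mod_cast hl
    have hl1 : (1 : ℝ) ≤ l := by exact_mod_cast hl
    have h1l : 1 / (l : ℝ) ≤ 1 := by rw [div_le_one hl0]; exact hl1
    have hpt : ∀ v : Vec d, (1 + (cE * (1 / (l : ℝ) + ‖v‖ ^ 2) + cD * ‖v‖)) ^ (2 * m + 2) - 1
        - (2 * m + 2) * (cE * (1 / (l : ℝ) + ‖v‖ ^ 2) + cD * ‖v‖) ≤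
        1 / (l : ℝ) * ((1 + (cE + cD)) ^ (2 * m + 2) *
          (1 + incrementSize l v) ^ (2 * (2 * m + 2))) := by
      intro v
      have h0 := incrementSize_nonneg l v
      -- Used with s = √(1/l), so that s² is the step size.
      have h3 := one_add_pow_taylor_le (2 * m)
        (by positivity : 0 ≤ cE * (1 / (l : ℝ) + ‖v‖ ^ 2) + cD * ‖v‖)
        (Real.sqrt_nonneg (1 / l)) (by rw [Real.sqrt_le_one]; exact h1l)
        (by positivity : 0 ≤ (cE + cD) * (1 + incrementSize l v) ^ 2)
        (total_noise_le hE hD hl v)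
      rw [Real.sq_sqrt (by positivity)] at h3
      push_cast at h3
      refine h3.trans (mul_le_mul_of_nonneg_left ?_ (by positivity))
      rw [pow_mul _ 2 (2 * m + 2), ← mul_pow]
      refine pow_le_pow_left₀ (by positivity) ?_ _
      nlinarith
    have hi := hB.integrable_one_add_noise_pow hE hD hl j (2 * m + 2)
    have hi1 : Integrable (fun ω => cE * (1 / (l : ℝ) + ‖increment (fun s => B s ω) l j‖ ^ 2)
        + cD * ‖increment (fun s => B s ω) l j‖) P :=
      ((hB.integrable_one_add_noise_pow hE hD hl j 1).sub (integrable_const 1)).congr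
        (.of_forall fun ω => by simp)
    refine (integral_mono ((hi.sub (integrable_const 1)).sub (hi1.const_mul _))
      (((h₂ l hl j).1.const_mul _).const_mul _) fun ω => hpt _).trans ?_
    rw [integral_const_mul, integral_const_mul, mul_comm]
    have := (h₂ l hl j).2
    gcongr
    have : 0 ≤ cE * M₁ := by positivity
    have : (1 + (cE + cD)) ^ (2 * m + 2) * ∫ ω, (1 + incrementSize l
        (increment (fun s => B s ω) l j)) ^ (2 * (2 * m + 2)) ∂P
        ≤ (1 + (cE + cD)) ^ (2 * m + 2) * M₂ := by gcongr
    linarith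

end NoiseSize

/-! ### Moment bounds for the scheme -/

section Moments

variable {Ω : Type*} {mΩ : MeasurableSpace Ω} {P : Measure Ω} [IsProbabilityMeasure P]
  {r : ℝ} (hr : 0 < r) {n d : ℕ} {B : ℝ≥0 → Ω → Vec d} {f : FadingSpace r n → Vec n}
  {g : FadingSpace r n → Matrix (Fin n) (Fin d) ℝ} {Λ : ℝ≥0 → ℝ≥0} {θ : ℝ}
  {a₁ a₂ q : ℝ} {μ : Measure RMinus}

variable (B f g Λ θ a₁ a₂ q μ) in
/-- The majorant process along the Brownian path, at step `j`. -/
noncomputable def schemeMajorant (ξ : FadingSpace r n) (k l j : ℕ) (ω : Ω) : ℝ × ℝ :=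
  majorant (initBound r a₂ q μ ξ)
    (fun i => stepNoise hr f g Λ θ ξ k l (fun s => B s ω) i (increment (fun s => B s ω) l i))
    (fun i => (4 * a₁ + 4 * driftConst f Λ ^ 2) *
      (1 / (l : ℝ) + ‖increment (fun s => B s ω) l i‖ ^ 2)) j

/-- The moments of the majorant grow at most exponentially, uniformly in `k` and `l`. -/
theorem exists_integral_schemeMajorant_le (hB : IsBrownianMotion B P)
    (hf : DriftLocallyLipschitz f) (hg : DiffusionLocallyLipschitz g)
    (hA : PathwiseAssumptions f g Λ θ a₁ a₂ q μ) (m : ℕ) :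
    ∃ C : ℝ, 0 < C ∧ ∀ (ξ : FadingSpace r n) (k l : ℕ), 1 ≤ l → ∀ J : ℕ,
      Integrable (fun ω => (schemeMajorant hr B f g Λ θ a₁ a₂ q μ ξ k l J ω).2 ^ (2 * m + 2)) P ∧
      ∫ ω, (schemeMajorant hr B f g Λ θ a₁ a₂ q μ ξ k l J ω).2 ^ (2 * m + 2) ∂P ≤
        4 * initBound r a₂ q μ ξ ^ (2 * m + 2) * Real.exp (C * (J / l)) := by
  have ha := hA.growth.a₁_pos
  have hL : 1 ≤ driftConst f Λ := one_le_driftConst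
  set cE := 4 * a₁ + 4 * driftConst f Λ ^ 2 with hcE
  -- Twice the constant of `abs_stepNoise_le`, because 1 + ‖X_{t_j}‖_r² ≤ 2S_j.
  set cD := 4 * (1 + 2 * driftConst f Λ) * Real.sqrt a₁ with hcD
  have hE : 0 ≤ cE := by positivity
  have hD : 0 ≤ cD := by positivity
  obtain ⟨κ, hκ, hκb⟩ := hB.exists_noise_bound hE hD m
  -- The added 1 keeps the rate positive even if κ = 0.
  refine ⟨4 * ((2 * m + 3) * κ) + 1, by positivity, fun ξ k l hl J => ?_⟩
  have hl0 : (0 : ℝ) < l := by exact_mod_cast hl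
  set z := initBound r a₂ q μ ξ with hz
  have hz0 : 0 ≤ z := by
    have := initBound_ge hr ξ hA
    have : 0 ≤ fadingNorm ξ ^ 2 * Real.exp (2 * r) := by positivity
    linarith
  set η : ℕ → Ω → Vec d := fun j ω => increment (fun s => B s ω) l j with hη
  set δ : ℕ → Ω → ℝ := fun j ω => stepNoise hr f g Λ θ ξ k l (fun s => B s ω) j (η j ω) with hδ
  set e : ℕ → Ω → ℝ := fun j ω => cE * (1 / (l : ℝ) + ‖η j ω‖ ^ 2) with he
  set y : ℕ → Ω → ℝ := fun j ω => cD * ‖η j ω‖ with hy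
  have hηm : ∀ j, Measurable[pastIncrements B l (j + 1)] (η j) :=
    measurable_pastIncrements_increment l
  have hmono := pastIncrements_mono (B := B) l
  have hle := hB.pastIncrements_le l
  have hδm : ∀ j, Measurable[pastIncrements B l (j + 1)] (δ j) := fun j =>
    measurable_stepNoise hr Λ θ ξ k l hf hg (w := fun ω s => B s ω) hmono hηm j
      (hmono j.le_succ) (hηm j)
  have hem : ∀ j, Measurable[pastIncrements B l (j + 1)] (e j) := fun j =>
    (by fun_prop : Measurable fun v : Vec d => cE * (1 / (l : ℝ) + ‖v‖ ^ 2)).comp (hηm j)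
  have hym : ∀ j, Measurable (y j) := fun j => (hB.measurable_increment l j).norm.const_mul _
  have he0 : ∀ j ω, 0 ≤ e j ω := fun j ω => by simp only [he]; positivity
  have hy0 : ∀ j ω, 0 ≤ y j ω := fun j ω => by simp only [hy]; positivity
  have hmaj := fun ω j => le_majorant hr ξ k (fun s => B s ω) hA hl j
  -- Stated for every v: the increment gives the bound on δ, the unit vectors give integrability of
  -- the coefficients `H`.
  have hnoise : ∀ j ω v, |stepNoise hr f g Λ θ ξ k l (fun s => B s ω) j v| ≤
      (majorant z (δ · ω) (e · ω) j).2 * (cD * ‖v‖) := by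
    intro j ω v
    refine (abs_stepNoise_le hr ξ k (fun s => B s ω) hA hl j v).trans ?_
    have h1 := mul_le_mul_of_nonneg_right (mul_le_mul_of_nonneg_left (hmaj ω j).2
      (by positivity : 0 ≤ 2 * (1 + 2 * driftConst f Λ) * Real.sqrt a₁)) (norm_nonneg v)
    refine h1.trans (le_of_eq ?_)
    simp only [hcD]
    ring
  have hδb : ∀ j ω, |δ j ω| ≤ (majorant z (δ · ω) (e · ω) j).2 * y j ω := fun j ω =>
    hnoise j ω (η j ω)
  have hind : ∀ j, Indep (pastIncrements B l j)
      (MeasurableSpace.comap (fun ω => e j ω + y j ω) inferInstance) P := fun j =>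
    hB.indep_pastIncrements_comp l j
      (ψ := fun v => cE * (1 / (l : ℝ) + ‖v‖ ^ 2) + cD * ‖v‖) (by fun_prop)
  have hinde : ∀ j, Indep (pastIncrements B l j)
      (MeasurableSpace.comap (e j) inferInstance) P := fun j =>
    hB.indep_pastIncrements_comp l j (ψ := fun v => cE * (1 / (l : ℝ) + ‖v‖ ^ 2)) (by fun_prop)
  have hint : ∀ j k, Integrable (fun ω => (1 + (e j ω + y j ω)) ^ k) P := fun j k =>
    hB.integrable_one_add_noise_pow hE hD hl j k
  have hSi := integrable_majorant_snd_pow hle hmono hz0 hδm hem hym he0 hy0 hδb hind hint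
  have hZ : ∀ j ω, 0 ≤ (majorant z (δ · ω) (e · ω) j).1 := fun j ω =>
    (sq_nonneg _).trans (hmaj ω j).1
  have hzero : ∀ a b j, ∫ ω, (majorant z (δ · ω) (e · ω) j).2 ^ a *
      (majorant z (δ · ω) (e · ω) j).1 ^ b * δ j ω ∂P = 0 := by
    intro a b j
    have hmm := measurable_majorant (z := z) hmono hδm hem j
    set H : Fin d → Ω → ℝ := fun c ω => (majorant z (δ · ω) (e · ω) j).2 ^ a *
      (majorant z (δ · ω) (e · ω) j).1 ^ b *
      stepNoise hr f g Λ θ ξ k l (fun s => B s ω) j (EuclideanSpace.single c 1) with hH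
    have hHm : ∀ c, Measurable[pastIncrements B l j] (H c) := fun c =>
      ((hmm.2.pow_const a).mul (hmm.1.pow_const b)).mul
        (measurable_stepNoise hr Λ θ ξ k l hf hg (w := fun ω s => B s ω) hmono hηm j
          le_rfl measurable_const)
    have hHi : ∀ c, Integrable (H c) P := fun c => by
      refine ((hSi (a + b + 1) j).const_mul cD).mono'
        ((hHm c).mono (hle j) le_rfl).aestronglyMeasurable (.of_forall fun ω => ?_)
      have h1 := hnoise j ω (EuclideanSpace.single c 1)
      rw [PiLp.norm_single, norm_one, mul_one] at h1
      have h2 := hZ j ω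
      have h3 := majorant_fst_le_snd z (δ · ω) (e · ω) j
      rw [norm_mul, norm_mul, norm_pow, norm_pow, Real.norm_of_nonneg h2,
        Real.norm_of_nonneg (h2.trans h3), Real.norm_eq_abs, pow_succ, pow_add]
      calc _ ≤ (majorant z (δ · ω) (e · ω) j).2 ^ a * (majorant z (δ · ω) (e · ω) j).2 ^ b *
            ((majorant z (δ · ω) (e · ω) j).2 * cD) := by
            have := h2.trans h3
            gcongr
        _ = _ := by ring
    have hηi := hB.integral_increment l j
    have hsum : ∀ ω, (majorant z (δ · ω) (e · ω) j).2 ^ a *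
        (majorant z (δ · ω) (e · ω) j).1 ^ b * δ j ω = ∑ c, H c ω * η j ω c := by
      intro ω
      have h1 : δ j ω = _ := stepNoise_eq_sum hr f g Λ θ ξ k l (fun s => B s ω) j (η j ω)
      rw [h1, Finset.mul_sum]
      refine Finset.sum_congr rfl fun c _ => ?_
      simp only [hH]
      ring
    have hprod : ∀ c, Integrable (fun ω => H c ω * η j ω c) P ∧
        ∫ ω, H c ω * η j ω c ∂P = (∫ ω, H c ω ∂P) * ∫ ω, η j ω c ∂P := fun c =>
      integral_mul_of_indep (hle j) (hHm c) (hB.measurable_increment_apply l j c)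
        (hB.indep_pastIncrements_comp l j (ψ := fun v => v c) (by fun_prop)) (hHi c) (hηi c).1
    simp only [hsum]
    rw [integral_finsetSum _ fun c _ => (hprod c).1]
    refine Finset.sum_eq_zero fun c _ => ?_
    rw [(hprod c).2, (hηi c).2, mul_zero]
  refine ⟨hSi (2 * m + 2) J, ?_⟩
  refine (integral_majorant_snd_pow_le hle hmono hz0 hδm hem hym he0 hy0 hδb hind hinde hint hZ
    hzero (m := m) (by positivity : 0 ≤ κ * (1 / (l : ℝ))) (fun j => (hκb l hl j).1)
    (fun j => (hκb l hl j).2) J).trans ?_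
  refine mul_le_mul_of_nonneg_left ?_ (by positivity)
  calc (1 + 4 * ((2 * m + 3) * (κ * (1 / (l : ℝ))))) ^ J
      ≤ Real.exp (4 * ((2 * m + 3) * (κ * (1 / (l : ℝ))))) ^ J := by
        refine pow_le_pow_left₀ (by positivity) ?_ J
        rw [add_comm]
        exact Real.add_one_le_exp _
    _ = Real.exp (4 * ((2 * m + 3) * κ) * (J / l)) := by
        rw [← Real.exp_nat_mul]
        congr 1
        ring
    _ ≤ _ := by
        gcongr
        linarith

/-- Since S is nondecreasing, its value at the last index dominates all times at once, so the
supremum under the expectation needs no further maximal inequality. As 2S ≥ 1, the exponent p/2 may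
be raised to an integer. -/
theorem iSup_fadingNorm_numericalSegment_le (hA : PathwiseAssumptions f g Λ θ a₁ a₂ q μ)
    (ξ : FadingSpace r n) (k : ℕ) {l : ℕ} (hl : 1 ≤ l) {p : ℝ} (hp : 0 < p) {m : ℕ}
    (hm : p / 2 ≤ m) (T : ℝ) (ω : Ω) :
    ⨆ t ∈ Set.Icc (0 : ℝ) T, ENNReal.ofReal
      (fadingNorm (numericalSegment hr f g Λ θ ξ k l (fun s => B s ω) t) ^ p) ≤
    ENNReal.ofReal
      ((2 * (schemeMajorant hr B f g Λ θ a₁ a₂ q μ ξ k l ⌊T * l⌋₊ ω).2) ^ m) := by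
  refine iSup₂_le fun t ht => ENNReal.ofReal_le_ofReal ?_
  have hl0 : (0 : ℝ) < l := by exact_mod_cast hl
  have hj : ⌊t * (l : ℝ)⌋₊ ≤ ⌊T * (l : ℝ)⌋₊ :=
    Nat.floor_mono (mul_le_mul_of_nonneg_right ht.2 hl0.le)
  have h1 := (le_majorant hr ξ k (fun s => B s ω) hA hl ⌊t * (l : ℝ)⌋₊).2
  have h2 : 1 + fadingNorm (numericalSegment hr f g Λ θ ξ k l (fun s => B s ω) t) ^ 2 ≤
      2 * (schemeMajorant hr B f g Λ θ a₁ a₂ q μ ξ k l ⌊T * l⌋₊ ω).2 :=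
    h1.trans (mul_le_mul_of_nonneg_left (majorant_snd_mono _ _ _ hj) (by norm_num))
  set N := fadingNorm (numericalSegment hr f g Λ θ ξ k l (fun s => B s ω) t) with hN
  have hN0 : 0 ≤ N := fadingNorm_nonneg _
  set s := 2 * (schemeMajorant hr B f g Λ θ a₁ a₂ q μ ξ k l ⌊T * l⌋₊ ω).2
  have hs : 1 ≤ s := by nlinarith
  calc N ^ p = (N ^ 2) ^ (p / 2) := by
        rw [← Real.rpow_natCast, ← Real.rpow_mul hN0]
        congr 1
        push_cast
        ring
    _ ≤ s ^ (p / 2) := Real.rpow_le_rpow (by positivity) (by linarith) (by linarith)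
    _ ≤ s ^ (m : ℝ) := Real.rpow_le_rpow_of_exponent_le hs hm
    _ = s ^ m := Real.rpow_natCast s m

/-- Exponential moment bound for the truncated Euler-Maruyama scheme, uniform in the memory length
and the step size. -/
theorem exists_lintegral_numericalSegment_le (hB : IsBrownianMotion B P)
    (hf : DriftLocallyLipschitz f) (hg : DiffusionLocallyLipschitz g)
    (hA : PathwiseAssumptions f g Λ θ a₁ a₂ q μ) {p : ℝ} (hp : 0 < p) :
    ∃ C : ℝ, 0 < C ∧ ∀ ξ : FadingSpace r n, ∃ Cξ : ℝ, 0 < Cξ ∧ ∀ T : ℝ, 0 < T →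
      ∀ k l : ℕ, 1 ≤ l → ∫⁻ ω, ⨆ t ∈ Set.Icc (0 : ℝ) T, ENNReal.ofReal
        (fadingNorm (numericalSegment hr f g Λ θ ξ k l (fun s => B s ω) t) ^ p) ∂P ≤
      ENNReal.ofReal (Cξ * Real.exp (C * T)) := by
  -- Moments of S are available for the exponents 2m + 2; any m with p/2 ≤ 2m + 2 would do.
  set m := ⌈p⌉₊ with hm
  obtain ⟨C, hC, hbound⟩ := exists_integral_schemeMajorant_le hr hB hf hg hA m
  refine ⟨C, hC, fun ξ => ?_⟩
  have hz : 0 < initBound r a₂ q μ ξ := by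
    have := initBound_ge hr ξ hA
    have : 0 ≤ fadingNorm ξ ^ 2 * Real.exp (2 * r) := by positivity
    linarith
  refine ⟨2 ^ (2 * m + 2) * (4 * initBound r a₂ q μ ξ ^ (2 * m + 2)), by positivity,
    fun T hT k l hl => ?_⟩
  have hl0 : (0 : ℝ) < l := by exact_mod_cast hl
  obtain ⟨hi, hle⟩ := hbound ξ k l hl ⌊T * l⌋₊
  have hpm : p / 2 ≤ (2 * m + 2 : ℕ) := by
    have := Nat.le_ceil p
    push_cast
    linarith
  refine (lintegral_mono fun ω =>
    iSup_fadingNorm_numericalSegment_le (B := B) hr hA ξ k hl hp hpm T ω).trans ?_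
  simp only [mul_pow]
  rw [← ofReal_integral_eq_lintegral_ofReal (hi.const_mul _) (.of_forall fun ω => by
    have : 0 ≤ (schemeMajorant hr B f g Λ θ a₁ a₂ q μ ξ k l ⌊T * l⌋₊ ω).2 :=
      hz.le.trans (le_majorant_snd _ _ _ _)
    positivity), integral_const_mul]
  refine ENNReal.ofReal_le_ofReal ?_
  rw [mul_assoc]
  refine mul_le_mul_of_nonneg_left (hle.trans ?_) (by positivity)
  gcongr
  rw [div_le_iff₀ hl0]
  exact Nat.floor_le (by positivity)

end Moments

end TEM

/-! ### The moment bound in its final form -/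

theorem theorem3p2
    {Ω : Type*} [MeasurableSpace Ω] (P : Measure Ω) [IsProbabilityMeasure P]
    {n d : ℕ} (B : ℝ≥0 → Ω → TEM.Vec d) (hB : TEM.IsBrownianMotion B P)
    (r : ℝ) (hr : 0 < r)
    (f : TEM.FadingSpace r n → TEM.Vec n)
    (g : TEM.FadingSpace r n → Matrix (Fin n) (Fin d) ℝ)
    (hf : TEM.DriftLocallyLipschitz f) (hg : TEM.DiffusionLocallyLipschitz g)
    (a₁ a₂ pbar : ℝ) (μ₁ : Measure TEM.RMinus)
    (hfg : TEM.KhasminskiiGrowth f g a₁ a₂ pbar μ₁)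
    (Λ : ℝ≥0 → ℝ≥0) (hΛ : Monotone Λ)
    (hfΛ : ∀ (R : ℝ≥0) (φ ψ : TEM.FadingSpace r n),
      TEM.fadingNorm φ ≤ R → TEM.fadingNorm ψ ≤ R →
        ‖f φ - f ψ‖ ≤ Λ R * TEM.fadingNorm (φ - ψ))
    (θ : ℝ) (hθ_pos : 0 < θ) (hθ_le : θ ≤ 1 / 2)
    (p : ℝ) (hp : 0 < p) :
    ∃ C : ℝ, 0 < C ∧ ∀ ξ : TEM.FadingSpace r n, ∃ Cξ : ℝ, 0 < Cξ ∧ ∀ T : ℝ, 0 < T →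
      (⨆ (k : ℕ) (_ : 1 ≤ k) (l : ℕ) (_ : 1 ≤ l),
        ∫⁻ ω, ⨆ t ∈ Set.Icc (0 : ℝ) T,
          ENNReal.ofReal
            (TEM.fadingNorm (TEM.numericalSegment hr f g Λ θ ξ k l (fun s => B s ω) t) ^ p) ∂P)
      ≤ ENNReal.ofReal
          (Cξ * Real.exp (C * (if a₂ = 0 then T else T ^ max 1 (p / 2)))) := by
  obtain ⟨C, hC, h⟩ := TEM.exists_lintegral_numericalSegment_le hr hB hf hg
    (⟨hfg, hfΛ, hθ_pos, hθ_le⟩ : TEM.PathwiseAssumptions f g Λ θ a₁ a₂ pbar μ₁) hp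
  refine ⟨C, hC, fun ξ => ?_⟩
  obtain ⟨Cξ, hCξ, hξ⟩ := h ξ
  refine ⟨Cξ * Real.exp C, by positivity, fun T hT => ?_⟩
  refine iSup₂_le fun k _ => iSup₂_le fun l hl => (hξ T hT k l hl).trans
    (ENNReal.ofReal_le_ofReal ?_)
  rw [mul_assoc, ← Real.exp_add]
  -- The bound e^{CT} holds in both cases; the power of T for a₂ ≠ 0 dominates T up to an additive
  -- 1, which the factor e^C in the prefactor absorbs.
  have hexp : T ≤ 1 + if a₂ = 0 then T else T ^ max 1 (p / 2) := by
    split_ifs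
    · linarith
    · rcases le_total T 1 with h1 | h1
      · have : 0 ≤ T ^ max 1 (p / 2) := by positivity
        linarith
      · have := Real.rpow_le_rpow_of_exponent_le h1 (le_max_left 1 (p / 2))
        rw [Real.rpow_one] at this
        linarith
  gcongr
  nlinarith [mul_le_mul_of_nonneg_left hexp hC.le]
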